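/- **Theorem 1.3.** Let $L>0$ and $m_0\in C^1_c(-L,L)$, and put $G(x)=\tfrac12e^{-|x|}$. Let $(u,m)$ with $u\in C^3_1(\mathbb R\times[0,T_{max}))$, $m\in C^1_1(\mathbb R\times[0,T_{max}))$ (three, resp. one, continuous $x$-derivatives and one continuous $t$-derivative) be the classical solution, with $m$ bounded on $\mathbb R\times[0,t]$ for every $t<T_{max}$, of the modified Camassa–Holm equation $$m_t+[(u^2-u_x^2)m]_x=0,\qquad m=u-u_{xx},\qquad u=G*m,\qquad m(\cdot,0)=m_0,$$ and assume that its maximal existence time $T_{max}$ is finite, $0<T_{max}<\infty$. Let $X\in C^2_1([-L,L]\times[0,T_{max}))$ be the solution of the Lagrange dynamics $X(\xi,0)=\xi$, $$\partial_tX(\xi,t)=\Big(\int_{-L}^{L}G(X(\xi,t)-X(\theta,t))m_0(\theta)\,d\theta\Big)^2-\Big(\int_{-L}^{L}G'(X(\xi,t)-X(\theta,t))m_0(\theta)\,d\theta\Big)^2,$$ extended to $t=T_{max}$ by $X(\xi,T_{max})=\lim_{t\uparrow T_{max}}X(\xi,t)$. Put $$F_{T_{max}}=\{X(\xi,T_{max}):\xi\in[-L,L],\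 X_\xi(\xi,T_{max})=0\},\qquad O_{T_{max}}=\{X(\xi,T_{max}):\xi\in(-L,L),\ X_\xi(\xi,T_{max})>0\},$$ and let $\widehat F_{T_{max}}$ be the set of $x\in F_{T_{max}}$ whose preimage $X^{-1}(x,T_{max})\subset[-L,L]$ is an interval $[\xi_1,\xi_2]$ with $\xi_1<\xi_2$. Suppose that $F_{T_{max}}$ is finite, $F_{T_{max}}=\{x_1,\dots,x_{N_1}\}$ with distinct $x_i$, that $\widehat F_{T_{max}}=\{x_1,\dots,x_N\}$ for some $N\le N_1$, and write $X^{-1}(x_i,T_{max})=[\xi_{i1},\xi_{i2}]$ and $p_i=\int_{\xi_{i1}}^{\xi_{i2}}m_0(\xi)\,d\xi$ for $1\le i\le N$. Then $m(\cdot,t)\,dx$ has, as $t\uparrow T_{max}$, a unique weak-$*$ limit $m(\cdot,T_{max})$ in the space of finite signed Radon measures on $\mathbb R$ (the dual of $C_0(\mathbb R)$), and $$m(\cdot,T_{max})=m_1\,dx+\sum_{i=1}^{N}p_i\,\delta_{x_i}.$$ Here $O_{T_{max}}$ is open, and $m_1\in L^1(\mathbb R)$ is the function that is zero outside $O_{T_{max}}$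 and on $O_{T_{max}}$ is continuous and equal to $m(\cdot,T_{max})$, that is, $m(A,T_{max})=\int_Am_1\,dx$ for all Borel sets $A\subset O_{T_{max}}$. Moreover $p_i\ne0$ for every $1\le i\le N$; thus the points that carry a point mass (peakon) of $m(\cdot,T_{max})$ are exactly the points of $\widehat F_{T_{max}}$. -/

import Mathlib

open Set Filter Topology MeasureTheory
open scoped ZeroAtInfty

noncomputable section

namespace MCH

/-- `f ∈ C^k_n(A × I)`: the pure `x`-derivatives of `f` up to order `k` and the pure
`t`-derivatives of `f` up to order `n` exist and are jointly continuous on `A × I`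
(one-sided derivatives at end points of `A` or `I`). -/
def MemC (k n : ℕ) (A I : Set ℝ) (f : ℝ → ℝ → ℝ) : Prop :=
  (∀ t ∈ I, ContDiffOn ℝ k (fun x => f x t) A) ∧
  (∀ x ∈ A, ContDiffOn ℝ n (fun t => f x t) I) ∧
  (∀ β ≤ k, ContinuousOn
    (fun q : ℝ × ℝ => iteratedDerivWithin β (fun x => f x q.2) A q.1) (A ×ˢ I)) ∧
  (∀ α ≤ n, ContinuousOn
    (fun q : ℝ × ℝ => iteratedDerivWithin α (fun t => f q.1 t) I q.2) (A ×ˢ I))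

/-- The fundamental solution of the Helmholtz operator `1 - ∂ₓₓ`. -/
def G (x : ℝ) : ℝ := (1 / 2) * Real.exp (-|x|)

/-- The derivative of `G` away from the origin (with value `0` at the origin). -/
def G' (x : ℝ) : ℝ := -Real.sign x * G x

/-- `(u, m)` is a classical solution on `ℝ × [0, T)` of the modified Camassa-Holm equation
`m_t + [(u² - u_x²) m]_x = 0`, `m = u - u_xx`, `u = G ∗ m`, with initial datum `m₀`.
As usual for classical solutions, `m` is bounded on `ℝ × [0, t]` for every `t < T`. -/
structure IsClassicalSolution (m₀ : ℝ → ℝ) (T : ℝ) (u m : ℝ → ℝ → ℝ) : Prop where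
  u_reg : MemC 3 1 univ (Ico 0 T) u
  m_reg : MemC 1 1 univ (Ico 0 T) m
  bounded : ∀ t ∈ Ico 0 T, ∃ C : ℝ, ∀ s ∈ Icc 0 t, ∀ x, |m x s| ≤ C
  convolution : ∀ t ∈ Ico 0 T, ∀ x, u x t = ∫ y, G (x - y) * m y t
  helmholtz : ∀ t ∈ Ico 0 T, ∀ x, m x t = u x t - iteratedDeriv 2 (fun y => u y t) x
  pde : ∀ t ∈ Ioo 0 T, ∀ x,
    deriv (fun s => m x s) t
      + deriv (fun y => ((u y t) ^ 2 - (deriv (fun z => u z t) y) ^ 2) * m y t) x = 0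
  initial : ∀ x, m x 0 = m₀ x

/-- `T` is the (finite) maximal existence time of the classical solution `(u, m)`: no classical
solution with the same datum exists on a longer time interval. -/
def IsMaximalClassicalSolution (m₀ : ℝ → ℝ) (T : ℝ) (u m : ℝ → ℝ → ℝ) : Prop :=
  IsClassicalSolution m₀ T u m ∧
    ∀ T' : ℝ, T < T' → ¬ ∃ u' m' : ℝ → ℝ → ℝ, IsClassicalSolution m₀ T' u' m'

/-- The velocity field of the Lagrange dynamics,
`U(x,t) = (∫ G(x - X(θ,t)) m₀(θ) dθ)² - (∫ G'(x - X(θ,t)) m₀(θ) dθ)²`. -/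
def velocity (L : ℝ) (m₀ : ℝ → ℝ) (X : ℝ → ℝ → ℝ) (x t : ℝ) : ℝ :=
  (∫ θ in (-L)..L, G (x - X θ t) * m₀ θ) ^ 2 - (∫ θ in (-L)..L, G' (x - X θ t) * m₀ θ) ^ 2

/-- `X ∈ C²₁([-L, L] × [0, T))` solves the Lagrange dynamics `∂ₜX(ξ,t) = U(X(ξ,t),t)`,
`X(ξ,0) = ξ`; its values at the final time `T` are the limits as `t ↑ T`. -/
structure IsLagrangeSolution (L : ℝ) (m₀ : ℝ → ℝ) (T : ℝ) (X : ℝ → ℝ → ℝ) : Prop where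
  reg : MemC 2 1 (Icc (-L) L) (Ico 0 T) X
  initial : ∀ ξ ∈ Icc (-L) L, X ξ 0 = ξ
  ode : ∀ ξ ∈ Icc (-L) L, ∀ t ∈ Ioo 0 T,
    HasDerivAt (fun s => X ξ s) (velocity L m₀ X (X ξ t) t) t
  final : ∀ ξ ∈ Icc (-L) L, Tendsto (fun t => X ξ t) (𝓝[<] T) (𝓝 (X ξ T))

/-- The set of labels in `[-L, L]` that the map `Y` sends to `x`. -/
def labels (L : ℝ) (Y : ℝ → ℝ) (x : ℝ) : Set ℝ := {ξ ∈ Icc (-L) L | Y ξ = x}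

/-- For `Y = X(·, T)`: the collision set `F_T = {Y ξ : ξ ∈ [-L, L], Y' ξ = 0}`. -/
def collisionSet (L : ℝ) (Y : ℝ → ℝ) : Set ℝ :=
  Y '' {ξ ∈ Icc (-L) L | HasDerivWithinAt Y 0 (Icc (-L) L) ξ}

/-- The points of the collision set whose preimage is a nondegenerate closed interval. -/
def intervalCollisionSet (L : ℝ) (Y : ℝ → ℝ) : Set ℝ :=
  {x ∈ collisionSet L Y | ∃ ξ₁ ξ₂ : ℝ, ξ₁ < ξ₂ ∧ labels L Y x = Icc ξ₁ ξ₂}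

/-- For `Y = X(·, T)`: the set `O_T = {Y ξ : ξ ∈ (-L, L), Y' ξ > 0}`. -/
def regularSet (L : ℝ) (Y : ℝ → ℝ) : Set ℝ :=
  Y '' {ξ ∈ Ioo (-L) L | ∃ d : ℝ, 0 < d ∧ HasDerivAt Y d ξ}

/-- Weak-* convergence `m(·, t) dx ⇀ μ` in the space of finite signed Radon measures on `ℝ`
(the dual of `C₀(ℝ)`) as `t ↑ T`. -/
def IsWeakStarLimit (m : ℝ → ℝ → ℝ) (T : ℝ) (μ : SignedMeasure ℝ) : Prop :=
  ∀ φ : C₀(ℝ, ℝ), Tendsto (fun t => ∫ x, φ x * m x t) (𝓝[<] T) (𝓝 (∫ᵛ x, φ x ∂<•μ))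

end MCH

end

/-!
The classical solution is transported along its characteristics, the flow `q` of `u² - u_x²`. On
compact time intervals this field and its `x`-derivative `2 u_x m` are bounded and continuous, so
`q(·, t)` is a `C¹` diffeomorphism of the line (`exists_flow`), and the equation says that `m(q, t) q_ξ = m₀`
(`IsClassicalSolution.exists_characteristics`). Hence `m(·, t) dx` is the image of `m₀ dξ` under
`q(·, t)`, and `u = G ∗ m`, `u_x = G' ∗ m` become integrals over the labels: `q` solves the Lagrange
dynamics. Solutions of the Lagrange dynamics are unique as long as they preserve the order of the
labels, because then the sign in `G'(X(ξ) - X(θ))` is that of `ξ - θ` and the velocity is Lipschitz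
(`abs_velocity_sub_le`); a continuation argument gives `X = q`
(`IsLagrangeSolution.eq_characteristics`).

Along characteristics `∂ₜ X_ξ = 2 u_x m X_ξ = 2 u_x(X, t) m₀(ξ)`, with `|u_x| ≤ ‖m₀‖₁ / 2`. So `X_ξ`
converges uniformly as `t ↑ T`, the final map `Y = X(·, T)` is `C¹` and nondecreasing, and
`Y_ξ(ξ) = 0` forces `m₀(ξ) ≠ 0` (`IsLagrangeSolution.exists_final_deriv`). By dominated convergence
the weak-* limit of `m(·, t) dx` is the image of `m₀ dξ` under `Y`
(`IsLagrangeSolution.tendsto_integral_mul_m`).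

It remains to compute this image. On the labels where `Y_ξ > 0` the map `Y` is injective and open,
and the change of variables formula gives the density `m₀ / Y_ξ` (`pushDensity`). As the collision
set is finite, the other labels are, up to finitely many, those of the collapsed intervals
`[aᵢ, bᵢ]`, each of which contributes `pᵢ` times a Dirac mass
(`IsMonotoneProfile.integral_eq_add_sum`). Finally `pᵢ ≠ 0`, since the continuous function `m₀` does
not vanish on `[aᵢ, bᵢ]`. Uniqueness of the limit is the fact that finite signed measures are
determined by `C₀` (`signedMeasure_ext_of_integral`).
-/

noncomputable section

namespace MCH

/-! ### Flows of bounded Lipschitz fields -/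

theorem eq_left_of_hasDerivAt_zero {f : ℝ → ℝ} {a b : ℝ} (hc : ContinuousOn f (Icc a b))
    (hd : ∀ t ∈ Ioo a b, HasDerivAt f 0 t) {t : ℝ} (ht : t ∈ Icc a b) : f t = f a := by
  rcases eq_or_lt_of_le ht.1 with rfl | hat
  · rfl
  obtain ⟨c, -, hc'⟩ := exists_hasDerivAt_eq_slope f (fun _ => 0) hat
    (hc.mono (Icc_subset_Icc_right ht.2)) (fun s hs => hd s ⟨hs.1, hs.2.trans_le ht.2⟩)
  have : t - a ≠ 0 := (sub_pos.2 hat).ne'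
  field_simp at hc'
  linarith

/-- Mean value theorem in integral form. -/
theorem sub_eq_mul_integral {V W : ℝ → ℝ} (hV : ∀ x, HasDerivAt V (W x) x) (hW : Continuous W)
    (a b : ℝ) : V b - V a = (b - a) * ∫ r in (0 : ℝ)..1, W (a + r * (b - a)) := by
  have h : ∀ r ∈ uIcc (0 : ℝ) 1,
      HasDerivAt (fun r => V (a + r * (b - a))) (W (a + r * (b - a)) * (b - a)) r := by
    intro r _
    have h1 : HasDerivAt (fun r : ℝ => a + r * (b - a)) (b - a) r := by
      simpa using ((hasDerivAt_id r).mul_const (b - a)).const_add a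
    exact (hV _).comp r h1
  have := intervalIntegral.integral_eq_sub_of_hasDerivAt h
    (Continuous.intervalIntegrable (by fun_prop) _ _)
  rw [intervalIntegral.integral_mul_const] at this
  simp only [one_mul, zero_mul, add_zero, add_sub_cancel] at this
  linarith

/-- A bounded continuous field `V` with bounded continuous space derivative `W` has on `[0, t₁]` a
flow `q` with finite displacement, which is differentiable in the label `ξ` with derivative
`exp (∫ W(q))`. -/
theorem exists_flow {V W : ℝ → ℝ → ℝ} {M K t₁ : ℝ} (ht₁ : 0 ≤ t₁)
    (hVc : Continuous fun z : ℝ × ℝ => V z.1 z.2) (hWc : Continuous fun z : ℝ × ℝ => W z.1 z.2)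
    (hVM : ∀ x t, |V x t| ≤ M) (hVW : ∀ x t, HasDerivAt (fun y => V y t) (W x t) x)
    (hWK : ∀ x t, |W x t| ≤ K) :
    ∃ q : ℝ → ℝ → ℝ, (Continuous fun z : ℝ × ℝ => q z.1 z.2) ∧ (∀ ξ, q ξ 0 = ξ) ∧
      (∀ ξ, ∀ t ∈ Ioo 0 t₁, HasDerivAt (q ξ) (V (q ξ t) t) t) ∧
      (∀ ξ, ∀ t ∈ Icc 0 t₁, |q ξ t - ξ| ≤ M * t₁) ∧
      ∀ t ∈ Icc 0 t₁, ∀ ξ,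
        HasDerivAt (fun η => q η t) (Real.exp (∫ s in (0 : ℝ)..t, W (q ξ s) s)) ξ := by
  have hM : 0 ≤ M := (abs_nonneg _).trans (hVM 0 0)
  have hK : 0 ≤ K := (abs_nonneg _).trans (hWK 0 0)
  have hlip : ∀ t, LipschitzWith K.toNNReal (fun x => V x t) := by
    intro t
    refine lipschitzWith_of_nnnorm_deriv_le (fun x => (hVW x t).differentiableAt) fun x => ?_
    rw [(hVW x t).deriv, ← NNReal.coe_le_coe, Real.coe_toNNReal K hK]
    exact hWK x t
  have hPL : ∀ ξ, IsPicardLindelof (fun t x => V x t) (⟨0, le_refl 0, ht₁⟩ : Icc 0 t₁) ξ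
      (M * t₁).toNNReal 0 M.toNNReal K.toNNReal := by
    intro ξ
    refine ⟨fun t _ => (hlip t).lipschitzOnWith, fun x _ => ?_, fun t _ x _ => ?_, ?_⟩
    · exact (hVc.comp (Continuous.prodMk_right x)).continuousOn
    · rw [Real.coe_toNNReal M hM]; exact hVM x t
    · rw [Real.coe_toNNReal M hM, Real.coe_toNNReal _ (mul_nonneg hM ht₁)]
      simp [ht₁]
  choose q₀ hq₀ hq₀' using fun ξ => (hPL ξ).exists_eq_forall_mem_Icc_hasDerivWithinAt₀
  have hq₀c : ∀ ξ, ContinuousOn (q₀ ξ) (Icc 0 t₁) := fun ξ => HasDerivWithinAt.continuousOn (hq₀' ξ)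
  have hq₀L : ∀ t ∈ Icc 0 t₁,
      LipschitzOnWith (Real.exp (K * t₁)).toNNReal (fun ξ => q₀ ξ t) univ := by
    intro t ht
    refine LipschitzOnWith.of_dist_le_mul fun ξ _ η _ => ?_
    have hr : ∀ ξ, ∀ t ∈ Ico 0 t₁, HasDerivWithinAt (q₀ ξ) (V (q₀ ξ t) t) (Ici t) t :=
      fun ξ t ht => (hq₀' ξ t (Ico_subset_Icc_self ht)).mono_of_mem_nhdsWithin
        (Icc_mem_nhdsGE_of_mem ht)
    have := dist_le_of_trajectories_ODE (v := fun t x => V x t) (δ := dist ξ η) hlip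
      (hq₀c ξ) (hr ξ) (hq₀c η) (hr η)
      (by rw [show q₀ ξ 0 = ξ from hq₀ ξ, show q₀ η 0 = η from hq₀ η]) t ht
    rw [Real.coe_toNNReal _ (Real.exp_pos _).le]
    refine this.trans ?_
    rw [mul_comm, Real.coe_toNNReal K hK, sub_zero]
    gcongr
    exact ht.2
  have hq₀cc : ContinuousOn (Function.uncurry q₀) (univ ×ˢ Icc 0 t₁) :=
    continuousOn_prod_of_continuousOn_lipschitzOnWith _ _ (fun ξ _ => hq₀c ξ) hq₀L
  -- beyond `[0, t₁]` the flow is frozen, which makes it globally continuous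
  let q : ℝ → ℝ → ℝ := fun ξ t => q₀ ξ (projIcc 0 t₁ ht₁ t)
  have hqq : ∀ ξ, ∀ t ∈ Icc 0 t₁, q ξ t = q₀ ξ t := fun ξ t ht => by
    simp only [q, projIcc_of_mem ht₁ ht]
  have hqc : Continuous fun z : ℝ × ℝ => q z.1 z.2 := by
    have : Continuous fun z : ℝ × ℝ => (z.1, (projIcc 0 t₁ ht₁ z.2 : ℝ)) := by fun_prop
    exact hq₀cc.comp_continuous this fun z => ⟨trivial, (projIcc 0 t₁ ht₁ z.2).2⟩
  have hq0 : ∀ ξ, q ξ 0 = ξ := fun ξ => (hqq ξ 0 ⟨le_rfl, ht₁⟩).trans (hq₀ ξ)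
  have hqd : ∀ ξ, ∀ t ∈ Ioo 0 t₁, HasDerivAt (q ξ) (V (q ξ t) t) t := by
    intro ξ t ht
    have h1 := (hq₀' ξ t (Ioo_subset_Icc_self ht)).hasDerivAt (Icc_mem_nhds ht.1 ht.2)
    rw [hqq ξ t (Ioo_subset_Icc_self ht)]
    refine h1.congr_of_eventuallyEq ?_
    filter_upwards [Icc_mem_nhds ht.1 ht.2] with s hs using hqq ξ s hs
  have hqξ : ∀ ξ, Continuous (q ξ) := fun ξ => hqc.comp (Continuous.prodMk_right ξ)
  refine ⟨q, hqc, hq0, hqd, fun ξ t ht => ?_, fun t ht ξ => ?_⟩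
  · rcases eq_or_lt_of_le ht.1 with rfl | h0t
    · simpa [hq0] using mul_nonneg hM ht₁
    obtain ⟨c, hc, hc'⟩ := exists_hasDerivAt_eq_slope (q ξ) (fun s => V (q ξ s) s) h0t
      (hqξ ξ).continuousOn (fun s hs => hqd ξ s ⟨hs.1, hs.2.trans_le ht.2⟩)
    have h2 : q ξ t - ξ = V (q ξ c) c * t := by
      rw [hc', hq0, sub_zero]; field_simp
    rw [h2, abs_mul, abs_of_pos h0t]
    exact mul_le_mul (hVM _ _) ht.2 h0t.le hM
  · -- the averaged slope of the field along the segment joining two trajectories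
    let c : ℝ → ℝ → ℝ := fun η s => ∫ r in (0 : ℝ)..1, W (q ξ s + r * (q η s - q ξ s)) s
    have hcc : Continuous fun z : ℝ × ℝ => c z.1 z.2 := by
      refine intervalIntegral.continuous_parametric_intervalIntegral_of_continuous'
        (f := fun (z : ℝ × ℝ) r => W (q ξ z.2 + r * (q z.1 z.2 - q ξ z.2)) z.2) ?_ 0 1
      have e1 : Continuous fun w : (ℝ × ℝ) × ℝ => q ξ w.1.2 := (hqξ ξ).comp (by fun_prop)
      have e2 : Continuous fun w : (ℝ × ℝ) × ℝ => q w.1.1 w.1.2 := hqc.comp (by fun_prop)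
      exact hWc.comp (f := fun w : (ℝ × ℝ) × ℝ =>
        (q ξ w.1.2 + w.2 * (q w.1.1 w.1.2 - q ξ w.1.2), w.1.2)) (by fun_prop)
    have hcη : ∀ η, Continuous (c η) := fun η => hcc.comp (Continuous.prodMk_right η)
    have key : ∀ η, q η t - q ξ t = (η - ξ) * Real.exp (∫ s in (0 : ℝ)..t, c η s) := by
      intro η
      have hI : ∀ s, HasDerivAt (fun s => ∫ r in (0 : ℝ)..s, c η r) (c η s) s := fun s =>
        intervalIntegral.integral_hasDerivAt_right ((hcη η).intervalIntegrable _ _)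
          ((hcη η).stronglyMeasurableAtFilter _ _) (hcη η).continuousAt
      have hz := eq_left_of_hasDerivAt_zero
        (f := fun s => (q η s - q ξ s) * Real.exp (-∫ r in (0 : ℝ)..s, c η r)) (a := 0) (b := t₁)
        (Continuous.continuousOn ?_) ?_ ht
      · simp only [hq0, intervalIntegral.integral_same, neg_zero, Real.exp_zero, mul_one] at hz
        rw [← hz, mul_assoc, ← Real.exp_add]; simp
      · have : Continuous fun s => ∫ r in (0 : ℝ)..s, c η r :=
          continuous_iff_continuousAt.2 fun s => (hI s).continuousAt
        have := hqξ η
        have := hqξ ξ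
        fun_prop
      · intro s hs
        have h1 := ((hqd η s hs).sub (hqd ξ s hs)).mul (hI s).neg.exp
        have h2 := sub_eq_mul_integral (fun x => hVW x s)
          (hWc.comp (Continuous.prodMk_left s)) (q ξ s) (q η s)
        refine h1.congr_deriv ?_
        simp only [Pi.neg_apply, Pi.sub_apply]
        rw [h2]
        simp only [c]
        ring
    have hcξ : ∀ s, c ξ s = W (q ξ s) s := fun s => by simp [c]
    have hΦ : Continuous fun η => Real.exp (∫ s in (0 : ℝ)..t, c η s) := by
      have := intervalIntegral.continuous_parametric_intervalIntegral_of_continuous' (f := c)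
        (μ := volume) hcc 0 t
      fun_prop
    rw [hasDerivAt_iff_tendsto_slope]
    -- in the limit `η → ξ` the averaged slope becomes `W` along the trajectory of `ξ`
    have hlim : Tendsto (fun η => Real.exp (∫ s in (0 : ℝ)..t, c η s)) (𝓝[≠] ξ)
        (𝓝 (Real.exp (∫ s in (0 : ℝ)..t, W (q ξ s) s))) := by
      have := hΦ.tendsto ξ
      simp only [hcξ] at this
      exact this.mono_left nhdsWithin_le_nhds
    refine hlim.congr' ?_
    filter_upwards [self_mem_nhdsWithin] with η hη
    rw [slope_def_field, key η, mul_div_cancel_left₀ _ (sub_ne_zero.2 hη)]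

/-! ### The kernel `G` -/

theorem continuous_G : Continuous G := by unfold G; fun_prop

theorem G_pos (x : ℝ) : 0 < G x := by unfold G; positivity

theorem G_le (x : ℝ) : G x ≤ 1 / 2 := by
  have : Real.exp (-|x|) ≤ 1 := Real.exp_le_one_iff.2 (by simp)
  unfold G; linarith

theorem integrable_G : Integrable G := by
  have h1 : IntegrableOn G (Ioi 0) := by
    refine IntegrableOn.congr_fun ((integrableOn_exp_neg_Ioi 0).const_mul (1 / 2)) (fun x hx => ?_)
      measurableSet_Ioi
    simp [G, abs_of_pos hx.out]
  have h2 : IntegrableOn G (Iic 0) := by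
    refine IntegrableOn.congr_fun ((integrableOn_exp_Iic 0).const_mul (1 / 2)) (fun x hx => ?_)
      measurableSet_Iic
    simp [G, abs_of_nonpos hx.out]
  rw [← integrableOn_univ, ← Iic_union_Ioi (a := (0 : ℝ))]
  exact h2.union h1

theorem abs_exp_neg_sub_le {a b : ℝ} (ha : 0 ≤ a) (hb : 0 ≤ b) :
    |Real.exp (-a) - Real.exp (-b)| ≤ |a - b| := by
  wlog hab : a ≤ b generalizing a b
  · rw [abs_sub_comm, abs_sub_comm a b]
    exact this hb ha (le_of_not_ge hab)
  have h1 : Real.exp (-b) ≤ Real.exp (-a) := Real.exp_le_exp.2 (by linarith)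
  rw [abs_of_nonneg (sub_nonneg.2 h1), abs_of_nonpos (sub_nonpos.2 hab)]
  have h2 : Real.exp (-b) = Real.exp (-a) * Real.exp (a - b) := by rw [← Real.exp_add]; ring_nf
  have h3 : Real.exp (-a) ≤ 1 := Real.exp_le_one_iff.2 (by linarith)
  have h4 := Real.add_one_le_exp (a - b)
  nlinarith [Real.exp_pos (-a)]

theorem abs_G_sub_le (a b : ℝ) : |G a - G b| ≤ 1 / 2 * |a - b| := by
  unfold G
  rw [← mul_sub, abs_mul, abs_of_pos (by norm_num : (0 : ℝ) < 1 / 2)]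
  refine mul_le_mul_of_nonneg_left ?_ (by norm_num)
  exact (abs_exp_neg_sub_le (abs_nonneg a) (abs_nonneg b)).trans (abs_abs_sub_abs_le a b)

theorem abs_G_le (x : ℝ) : |G x| ≤ 1 / 2 := by
  rw [abs_of_pos (G_pos x)]; exact G_le x

theorem abs_sign_le_one (x : ℝ) : |Real.sign x| ≤ 1 := by
  rcases Real.sign_apply_eq x with h | h | h <;> simp [h]

theorem abs_G'_le (x : ℝ) : |G' x| ≤ 1 / 2 := by
  unfold G'
  rw [abs_mul, abs_neg]
  calc _ ≤ 1 * |G x| := mul_le_mul_of_nonneg_right (abs_sign_le_one x) (abs_nonneg _)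
    _ ≤ _ := by simpa using abs_G_le x

theorem measurable_G' : Measurable G' := by
  have : Measurable Real.sign := by
    unfold Real.sign
    exact Measurable.ite measurableSet_Iio measurable_const
      (Measurable.ite measurableSet_Ioi measurable_const measurable_const)
  exact this.neg.mul continuous_G.measurable

theorem hasDerivAt_G {x : ℝ} (hx : x ≠ 0) : HasDerivAt G (G' x) x := by
  rcases lt_or_gt_of_ne hx with h | h
  · have h1 : HasDerivAt (fun y => 1 / 2 * Real.exp y) (1 / 2 * Real.exp x) x :=
      (Real.hasDerivAt_exp x).const_mul _
    refine (h1.congr_of_eventuallyEq ?_).congr_deriv ?_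
    · filter_upwards [Iio_mem_nhds h] with y hy
      simp [G, abs_of_neg hy.out]
    · simp [G', G, Real.sign_of_neg h, abs_of_neg h]
  · have h1 : HasDerivAt (fun y => 1 / 2 * Real.exp (-y)) (1 / 2 * (Real.exp (-x) * -1)) x :=
      ((hasDerivAt_neg x).exp).const_mul _
    refine (h1.congr_of_eventuallyEq ?_).congr_deriv ?_
    · filter_upwards [Ioi_mem_nhds h] with y hy
      simp [G, abs_of_pos hy.out]
    · simp [G', G, Real.sign_of_pos h, abs_of_pos h]

/-! ### Classical solutions -/

/-- The spatial derivative `u_x`. -/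
def ux (u : ℝ → ℝ → ℝ) (x t : ℝ) : ℝ := deriv (fun y => u y t) x

section Classical

variable {m₀ : ℝ → ℝ} {T : ℝ} {u m : ℝ → ℝ → ℝ}

theorem IsClassicalSolution.hasDerivAt_u (h : IsClassicalSolution m₀ T u m) {t : ℝ}
    (ht : t ∈ Ico 0 T) (x : ℝ) : HasDerivAt (fun y => u y t) (ux u x t) x := by
  have := (contDiffOn_univ.1 (h.u_reg.1 t ht)).differentiable (by norm_num)
  exact (this x).hasDerivAt

theorem IsClassicalSolution.hasDerivAt_ux (h : IsClassicalSolution m₀ T u m) {t : ℝ}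
    (ht : t ∈ Ico 0 T) (x : ℝ) : HasDerivAt (fun y => ux u y t) (u x t - m x t) x := by
  have h1 : ContDiff ℝ 2 (deriv fun y => u y t) := by
    have := contDiffOn_univ.1 (h.u_reg.1 t ht)
    exact ContDiff.deriv' (n := 2) (this.of_le (by norm_num))
  have h2 := (h1.differentiable (by norm_num) x).hasDerivAt
  have h3 := h.helmholtz t ht x
  rw [iteratedDeriv_succ, iteratedDeriv_one] at h3
  rw [h3, sub_sub_cancel]
  exact h2

theorem IsClassicalSolution.hasDerivAt_m (h : IsClassicalSolution m₀ T u m) {t : ℝ}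
    (ht : t ∈ Ico 0 T) (x : ℝ) : HasDerivAt (fun y => m y t) (deriv (fun y => m y t) x) x := by
  have := (contDiffOn_univ.1 (h.m_reg.1 t ht)).differentiable (by norm_num)
  exact (this x).hasDerivAt

theorem IsClassicalSolution.hasDerivAt_m_time (h : IsClassicalSolution m₀ T u m) {t : ℝ}
    (ht : t ∈ Ioo 0 T) (x : ℝ) : HasDerivAt (fun s => m x s) (deriv (fun s => m x s) t) t := by
  have := (h.m_reg.2.1 x (mem_univ x)).differentiableOn (by norm_num) t (Ioo_subset_Ico_self ht)
  exact (this.differentiableAt (Ico_mem_nhds ht.1 ht.2)).hasDerivAt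

theorem IsClassicalSolution.continuousOn_u (h : IsClassicalSolution m₀ T u m) :
    ContinuousOn (fun z : ℝ × ℝ => u z.1 z.2) (univ ×ˢ Ico 0 T) := by
  simpa using h.u_reg.2.2.1 0 (by norm_num)

theorem IsClassicalSolution.continuousOn_ux (h : IsClassicalSolution m₀ T u m) :
    ContinuousOn (fun z : ℝ × ℝ => ux u z.1 z.2) (univ ×ˢ Ico 0 T) := by
  simpa [iteratedDerivWithin_univ, iteratedDeriv_one, ux] using h.u_reg.2.2.1 1 (by norm_num)

theorem IsClassicalSolution.continuousOn_m (h : IsClassicalSolution m₀ T u m) :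
    ContinuousOn (fun z : ℝ × ℝ => m z.1 z.2) (univ ×ˢ Ico 0 T) := by
  simpa using h.m_reg.2.2.1 0 (by norm_num)

theorem IsClassicalSolution.continuousOn_deriv_m (h : IsClassicalSolution m₀ T u m) :
    ContinuousOn (fun z : ℝ × ℝ => deriv (fun y => m y z.2) z.1) (univ ×ˢ Ico 0 T) := by
  simpa [iteratedDerivWithin_univ, iteratedDeriv_one] using h.m_reg.2.2.1 1 (by norm_num)

theorem IsClassicalSolution.continuousOn_deriv_m_time (h : IsClassicalSolution m₀ T u m) :
    ContinuousOn (fun z : ℝ × ℝ => deriv (fun s => m z.1 s) z.2) (univ ×ˢ Ioo 0 T) := by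
  refine ((h.m_reg.2.2.2 1 le_rfl).mono
    (prod_mono_right Ioo_subset_Ico_self)).congr fun z hz => ?_
  beta_reduce
  rw [iteratedDerivWithin_one]
  exact (derivWithin_of_mem_nhds (Ico_mem_nhds hz.2.1 hz.2.2)).symm

/-- The space derivative of the velocity `u² - u_x²` is `2 u_x m`, since `u - u_xx = m`. -/
theorem IsClassicalSolution.hasDerivAt_flux (h : IsClassicalSolution m₀ T u m) {t : ℝ}
    (ht : t ∈ Ico 0 T) (x : ℝ) :
    HasDerivAt (fun y => u y t ^ 2 - ux u y t ^ 2) (2 * ux u x t * m x t) x := by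
  refine (((h.hasDerivAt_u ht x).pow 2).sub ((h.hasDerivAt_ux ht x).pow 2)).congr_deriv ?_
  simp; ring

/-- The equation in transport form. -/
theorem IsClassicalSolution.deriv_m_time (h : IsClassicalSolution m₀ T u m) {t : ℝ}
    (ht : t ∈ Ioo 0 T) (x : ℝ) :
    deriv (fun s => m x s) t = -(2 * ux u x t * m x t * m x t
      + (u x t ^ 2 - ux u x t ^ 2) * deriv (fun y => m y t) x) := by
  have ht' := Ioo_subset_Ico_self ht
  have h1 := ((h.hasDerivAt_flux ht' x).mul (h.hasDerivAt_m ht' x)).deriv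
  have h2 := h.pde t ht x
  have h3 : deriv (fun y => ((u y t) ^ 2 - (deriv (fun z => u z t) y) ^ 2) * m y t) x
    = 2 * ux u x t * m x t * m x t
      + (u x t ^ 2 - ux u x t ^ 2) * deriv (fun y => m y t) x := h1
  linarith

/-- Chain rule for `m` along a curve; `m` is jointly differentiable as its partial derivatives are
jointly continuous. -/
theorem IsClassicalSolution.hasDerivAt_m_comp (h : IsClassicalSolution m₀ T u m) {t v : ℝ}
    (ht : t ∈ Ioo 0 T) {γ : ℝ → ℝ} (hγ : HasDerivAt γ v t) :
    HasDerivAt (fun s => m (γ s) s)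
      (deriv (fun y => m y t) (γ t) * v + deriv (fun s => m (γ t) s) t) t := by
  have hn : ∀ᶠ z : ℝ × ℝ in 𝓝 (γ t, t), z ∈ (univ : Set ℝ) ×ˢ Ioo 0 T :=
    (isOpen_univ.prod isOpen_Ioo).mem_nhds ⟨trivial, ht⟩
  have hs := hasStrictFDerivAt_uncurry_coprod (𝕜 := ℝ) (u := (γ t, t)) (f := m)
    (f₁ := fun x t => ContinuousLinearMap.toSpanSingleton ℝ (deriv (fun y => m y t) x))
    (f₂ := fun x t => ContinuousLinearMap.toSpanSingleton ℝ (deriv (fun s => m x s) t))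
    (hn.mono fun z hz => (h.hasDerivAt_m (Ioo_subset_Ico_self hz.2) z.1).hasFDerivAt)
    (hn.mono fun z hz => (h.hasDerivAt_m_time hz.2 z.1).hasFDerivAt)
    ?_ ?_
  · have h1 := HasFDerivAt.comp_hasDerivAt (f := fun s => (γ s, s)) t hs.hasFDerivAt
      (hγ.prodMk (hasDerivAt_id t))
    refine h1.congr_deriv ?_
    simp [Function.HasUncurry.uncurry, mul_comm]
  · have := (h.continuousOn_deriv_m.mono (prod_mono_right Ioo_subset_Ico_self)).continuousAt hn
    exact (ContinuousLinearMap.toSpanSingletonCLE (𝕜 := ℝ) (E := ℝ)).continuous.continuousAt.comp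
      this
  · have := h.continuousOn_deriv_m_time.continuousAt hn
    exact (ContinuousLinearMap.toSpanSingletonCLE (𝕜 := ℝ) (E := ℝ)).continuous.continuousAt.comp
      this

/-- On compact time intervals `u` and `u_x` are bounded: `u = G ∗ m` is bounded since `m` is, so
`u_xx = u - m` is bounded, and a function with bounded second derivative whose increments over
unit steps are bounded has bounded first derivative. -/
theorem IsClassicalSolution.exists_bound (h : IsClassicalSolution m₀ T u m) {t₁ : ℝ}
    (ht₁ : t₁ ∈ Ico 0 T) : ∃ C : ℝ, 0 ≤ C ∧ ∀ t ∈ Icc 0 t₁, ∀ x,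
      |m x t| ≤ C ∧ |u x t| ≤ C ∧ |ux u x t| ≤ C := by
  obtain ⟨C, hC⟩ := h.bounded t₁ ht₁
  have hC0 : 0 ≤ C := (abs_nonneg _).trans (hC 0 ⟨le_rfl, ht₁.1⟩ 0)
  set A := C * ∫ y, G y with hA
  have hA0 : 0 ≤ A := mul_nonneg hC0 (integral_nonneg fun y => (G_pos y).le)
  have hu : ∀ t ∈ Icc 0 t₁, ∀ x, |u x t| ≤ A := by
    intro t ht x
    rw [h.convolution t ⟨ht.1, ht.2.trans_lt ht₁.2⟩ x]
    have hi : Integrable (fun y => C * G (x - y)) := (integrable_G.comp_sub_left x).const_mul C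
    have := norm_integral_le_of_norm_le (f := fun y => G (x - y) * m y t) hi
      (Eventually.of_forall fun y => by
        rw [norm_mul, Real.norm_of_nonneg (G_pos _).le, mul_comm]
        exact mul_le_mul_of_nonneg_right (hC t ht y) (G_pos _).le)
    rwa [integral_const_mul, integral_sub_left_eq_self G volume x] at this
  refine ⟨3 * A + C, by positivity, fun t ht x => ⟨by linarith [hC t ht x],
    by linarith [hu t ht x], ?_⟩⟩
  have ht' : t ∈ Ico 0 T := ⟨ht.1, ht.2.trans_lt ht₁.2⟩
  have hd := h.hasDerivAt_u ht'
  have hd' := h.hasDerivAt_ux ht'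
  obtain ⟨c, hc, hc'⟩ := exists_hasDerivAt_eq_slope (fun y => u y t) (fun y => ux u y t)
    (lt_add_one x) (fun y _ => (hd y).continuousAt.continuousWithinAt) (fun y _ => hd y)
  obtain ⟨d, hd1, hd2⟩ := exists_hasDerivAt_eq_slope (fun y => ux u y t) (fun y => u y t - m y t)
    hc.1 (fun y _ => (hd' y).continuousAt.continuousWithinAt) (fun y _ => hd' y)
  have e1 : ux u c t = u (x + 1) t - u x t := by rw [hc']; ring
  have e2 : ux u c t - ux u x t = (u d t - m d t) * (c - x) := by
    rw [hd2, div_mul_cancel₀ _ (sub_pos.2 hc.1).ne']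
  have e3 : |(u d t - m d t) * (c - x)| ≤ A + C := by
    rw [abs_mul, abs_of_pos (sub_pos.2 hc.1)]
    have h1 : |u d t - m d t| ≤ A + C := (abs_sub _ _).trans (add_le_add (hu t ht d) (hC t ht d))
    have h2 : c - x ≤ 1 := by linarith [hc.2]
    calc _ ≤ |u d t - m d t| * 1 := mul_le_mul_of_nonneg_left h2 (abs_nonneg _)
      _ ≤ _ := by simpa using h1
  have e4 := hu t ht (x + 1)
  have e5 := hu t ht x
  rw [abs_le] at e3 e4 e5 ⊢
  constructor <;> linarith [e3.1, e3.2, e4.1, e4.2, e5.1, e5.2]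

end Classical

/-! ### Characteristics of a classical solution -/

section Characteristics

variable {m₀ : ℝ → ℝ} {T : ℝ} {u m : ℝ → ℝ → ℝ}

/-- Clamping of the time variable to `[0, t₁]`. -/
def clamp (t₁ t : ℝ) : ℝ := max 0 (min t t₁)

theorem clamp_of_mem {t₁ t : ℝ} (ht : t ∈ Icc 0 t₁) : clamp t₁ t = t := by
  simp [clamp, ht.1, ht.2]

theorem clamp_mem {t₁ : ℝ} (ht₁ : 0 ≤ t₁) (t : ℝ) : clamp t₁ t ∈ Icc 0 t₁ :=
  ⟨le_max_left _ _, max_le ht₁ (min_le_right _ _)⟩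

theorem continuous_clamp (t₁ : ℝ) : Continuous (clamp t₁) := by unfold clamp; fun_prop

/-- The characteristics of a classical solution on `[0, t₁]`: a flow `q` by diffeomorphisms of the
line, with label derivative `J`, along which `m J` is conserved. -/
structure Characteristics (m₀ : ℝ → ℝ) (u m : ℝ → ℝ → ℝ) (t₁ : ℝ) (q J : ℝ → ℝ → ℝ) : Prop where
  cont : Continuous fun z : ℝ × ℝ => q z.1 z.2
  initial : ∀ ξ, q ξ 0 = ξ
  ode : ∀ ξ, ∀ t ∈ Ioo 0 t₁, HasDerivAt (q ξ) (u (q ξ t) t ^ 2 - ux u (q ξ t) t ^ 2) t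
  surj : ∀ t ∈ Icc 0 t₁, Function.Surjective fun ξ => q ξ t
  hasDerivAt : ∀ t ∈ Icc 0 t₁, ∀ ξ, HasDerivAt (fun η => q η t) (J ξ t) ξ
  pos : ∀ ξ t, 0 < J ξ t
  contJ : Continuous fun z : ℝ × ℝ => J z.1 z.2
  conserved : ∀ t ∈ Icc 0 t₁, ∀ ξ, m (q ξ t) t * J ξ t = m₀ ξ
  odeJ : ∀ ξ, ∀ t ∈ Ioo 0 t₁, HasDerivAt (J ξ) (2 * ux u (q ξ t) t * m₀ ξ) t

/-- A classical solution has characteristics on every compact time interval. The field is extended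
to all times by freezing it outside `[0, t₁]`. -/
theorem IsClassicalSolution.exists_characteristics (h : IsClassicalSolution m₀ T u m) {t₁ : ℝ}
    (ht₁ : t₁ ∈ Ico 0 T) : ∃ q J : ℝ → ℝ → ℝ, Characteristics m₀ u m t₁ q J := by
  obtain ⟨C, hC0, hC⟩ := h.exists_bound ht₁
  have hτ := clamp_mem ht₁.1
  have hτT : ∀ t, clamp t₁ t ∈ Ico 0 T := fun t => ⟨(hτ t).1, (hτ t).2.trans_lt ht₁.2⟩
  have hcl : Continuous fun z : ℝ × ℝ => (z.1, clamp t₁ z.2) := by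
    have := continuous_clamp t₁
    fun_prop
  have cu : Continuous fun z : ℝ × ℝ => u z.1 (clamp t₁ z.2) :=
    h.continuousOn_u.comp_continuous hcl fun z => ⟨trivial, hτT _⟩
  have cux : Continuous fun z : ℝ × ℝ => ux u z.1 (clamp t₁ z.2) :=
    h.continuousOn_ux.comp_continuous hcl fun z => ⟨trivial, hτT _⟩
  have cm : Continuous fun z : ℝ × ℝ => m z.1 (clamp t₁ z.2) :=
    h.continuousOn_m.comp_continuous hcl fun z => ⟨trivial, hτT _⟩
  let V : ℝ → ℝ → ℝ := fun x t => u x (clamp t₁ t) ^ 2 - ux u x (clamp t₁ t) ^ 2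
  let W : ℝ → ℝ → ℝ := fun x t => 2 * ux u x (clamp t₁ t) * m x (clamp t₁ t)
  have hWc : Continuous fun z : ℝ × ℝ => W z.1 z.2 := (continuous_const.mul cux).mul cm
  have hVM : ∀ x t, |V x t| ≤ C ^ 2 := by
    intro x t
    obtain ⟨-, h2, h3⟩ := hC _ (hτ t) x
    have h2' := sq_le_sq' (abs_le.1 h2).1 (abs_le.1 h2).2
    have h3' := sq_le_sq' (abs_le.1 h3).1 (abs_le.1 h3).2
    rw [abs_le]
    constructor <;> simp only [V] <;>
      nlinarith [sq_nonneg (u x (clamp t₁ t)), sq_nonneg (ux u x (clamp t₁ t))]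
  have hWK : ∀ x t, |W x t| ≤ 2 * C * C := by
    intro x t
    obtain ⟨h1, h2, h3⟩ := hC _ (hτ t) x
    simp only [W]
    rw [abs_mul, abs_mul, abs_of_pos (two_pos : (0 : ℝ) < 2)]
    gcongr
  obtain ⟨q, hqc, hq0, hqd, hqM, hqJ⟩ := exists_flow (V := V) (W := W) (M := C ^ 2)
    (K := 2 * C * C) ht₁.1 ((cu.pow 2).sub (cux.pow 2)) hWc hVM
    (fun x t => h.hasDerivAt_flux (hτT t) x) hWK
  have hqξ : ∀ ξ, Continuous (q ξ) := fun ξ => hqc.comp (Continuous.prodMk_right ξ)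
  have hWqc : Continuous fun z : ℝ × ℝ => W (q z.1 z.2) z.2 :=
    hWc.comp (f := fun z : ℝ × ℝ => (q z.1 z.2, z.2)) (by fun_prop)
  have hWq : ∀ ξ, Continuous fun s => W (q ξ s) s := fun ξ =>
    hWqc.comp (Continuous.prodMk_right ξ)
  let J : ℝ → ℝ → ℝ := fun ξ t => Real.exp (∫ s in (0 : ℝ)..t, W (q ξ s) s)
  have hJd : ∀ ξ t, HasDerivAt (J ξ) (J ξ t * W (q ξ t) t) t := fun ξ t =>
    (intervalIntegral.integral_hasDerivAt_right ((hWq ξ).intervalIntegrable _ _)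
      ((hWq ξ).stronglyMeasurableAtFilter _ _) (hWq ξ).continuousAt).exp
  have hcons : ∀ t ∈ Icc 0 t₁, ∀ ξ, m (q ξ t) t * J ξ t = m₀ ξ := by
    intro t ht ξ
    have hz := eq_left_of_hasDerivAt_zero (f := fun s => m (q ξ s) (clamp t₁ s) * J ξ s)
      (a := 0) (b := t₁) (Continuous.continuousOn ?_) ?_ ht
    · rw [clamp_of_mem ht, clamp_of_mem ⟨le_rfl, ht₁.1⟩, hq0, h.initial] at hz
      simpa [J] using hz
    · exact (cm.comp (f := fun s => (q ξ s, s)) (by fun_prop)).mul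
        (continuous_iff_continuousAt.2 fun s => (hJd ξ s).continuousAt)
    · intro s hs
      have hsT : s ∈ Ioo 0 T := ⟨hs.1, hs.2.trans ht₁.2⟩
      have h1 := (h.hasDerivAt_m_comp hsT (hqd ξ s hs)).mul (hJd ξ s)
      have h2 : HasDerivAt (fun s => m (q ξ s) s * J ξ s) 0 s := by
        refine h1.congr_deriv ?_
        rw [h.deriv_m_time hsT]
        simp only [V, W, clamp_of_mem (Ioo_subset_Icc_self hs)]
        ring
      refine h2.congr_of_eventuallyEq ?_
      filter_upwards [Icc_mem_nhds hs.1 hs.2] with r hr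
      rw [clamp_of_mem hr]
  refine ⟨q, J, hqc, hq0, fun ξ t ht => ?_, fun t ht => ?_, hqJ, fun ξ t => Real.exp_pos _, ?_,
    hcons, fun ξ t ht => ?_⟩
  · have := hqd ξ t ht
    simp only [V, clamp_of_mem (Ioo_subset_Icc_self ht)] at this
    exact this
  · have hc : Continuous fun ξ => q ξ t := hqc.comp (Continuous.prodMk_left t)
    refine hc.surjective ?_ ?_
    · refine tendsto_atTop_mono (fun ξ => ?_)
        (tendsto_atTop_add_const_right atTop (-(C ^ 2 * t₁)) tendsto_id)
      have := (abs_le.1 (hqM ξ t ht)).1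
      simp only [id]; linarith
    · refine tendsto_atBot_mono (fun ξ => ?_)
        (tendsto_atBot_add_const_right atBot (C ^ 2 * t₁) tendsto_id)
      have := (abs_le.1 (hqM ξ t ht)).2
      simp only [id]; linarith
  · exact (intervalIntegral.continuous_parametric_intervalIntegral_of_continuous
      (f := fun (z : ℝ × ℝ) s => W (q z.1 s) s)
      (hWqc.comp (f := fun w : (ℝ × ℝ) × ℝ => (w.1.1, w.2)) (by fun_prop)) continuous_snd).rexp
  · refine (hJd ξ t).congr_deriv ?_
    rw [← hcons t (Ioo_subset_Icc_self ht) ξ]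
    simp only [W, clamp_of_mem (Ioo_subset_Icc_self ht)]
    ring

end Characteristics

/-! ### Label representation of `u` and `u_x` -/

theorem Characteristics.strictMono {m₀ : ℝ → ℝ} {u m : ℝ → ℝ → ℝ} {t₁ : ℝ} {q J : ℝ → ℝ → ℝ}
    (hc : Characteristics m₀ u m t₁ q J) {t : ℝ} (ht : t ∈ Icc 0 t₁) :
    StrictMono fun ξ => q ξ t :=
  strictMono_of_hasDerivAt_pos (hc.hasDerivAt t ht) fun ξ => hc.pos ξ t

/-- `m(·, t) dx` is the image of `m₀ dξ` under the flow. -/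
theorem Characteristics.integral_mul_m {m₀ : ℝ → ℝ} {u m : ℝ → ℝ → ℝ} {t₁ : ℝ} {q J : ℝ → ℝ → ℝ}
    (hc : Characteristics m₀ u m t₁ q J) {t : ℝ} (ht : t ∈ Icc 0 t₁) (φ : ℝ → ℝ) :
    ∫ x, φ x * m x t = ∫ ξ, φ (q ξ t) * m₀ ξ := by
  have h := integral_image_eq_integral_deriv_smul_of_monotoneOn (s := univ) MeasurableSet.univ
    (fun ξ _ => (hc.hasDerivAt t ht ξ).hasDerivWithinAt) ((hc.strictMono ht).monotone.monotoneOn _)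
    (fun x => φ x * m x t)
  rw [image_univ, (hc.surj t ht).range_eq, Measure.restrict_univ] at h
  rw [h]
  refine integral_congr_ae (Eventually.of_forall fun ξ => ?_)
  simp only [smul_eq_mul]
  rw [← hc.conserved t ht ξ]
  ring

section

variable {L : ℝ} {m₀ : ℝ → ℝ}

theorem integral_mul_eq_intervalIntegral (hsupp : tsupport m₀ ⊆ Ioo (-L) L) (f : ℝ → ℝ) :
    ∫ ξ, f ξ * m₀ ξ = ∫ ξ in (-L)..L, f ξ * m₀ ξ := by
  refine (intervalIntegral.integral_eq_integral_of_support_subset fun ξ hξ => ?_).symm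
  have : m₀ ξ ≠ 0 := fun h => hξ (by simp [h])
  exact Ioo_subset_Ioc_self (hsupp (subset_tsupport _ this))

variable {T : ℝ} {u m : ℝ → ℝ → ℝ} {t₁ : ℝ} {q J : ℝ → ℝ → ℝ}

/-- In label coordinates, `u = G ∗ m` is the first integral of the Lagrange velocity. -/
theorem IsClassicalSolution.u_eq (h : IsClassicalSolution m₀ T u m)
    (hsupp : tsupport m₀ ⊆ Ioo (-L) L) (ht₁ : t₁ ∈ Ico 0 T)
    (hc : Characteristics m₀ u m t₁ q J) {t : ℝ} (ht : t ∈ Icc 0 t₁) (x : ℝ) :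
    u x t = ∫ θ in (-L)..L, G (x - q θ t) * m₀ θ := by
  rw [h.convolution t ⟨ht.1, ht.2.trans_lt ht₁.2⟩, hc.integral_mul_m ht (fun y => G (x - y)),
    integral_mul_eq_intervalIntegral hsupp]

/-- In label coordinates, `u_x` is the second integral of the Lagrange velocity. -/
theorem IsClassicalSolution.ux_eq (h : IsClassicalSolution m₀ T u m) (hm₀ : Continuous m₀)
    (hsupp : tsupport m₀ ⊆ Ioo (-L) L) (ht₁ : t₁ ∈ Ico 0 T)
    (hc : Characteristics m₀ u m t₁ q J) {t : ℝ} (ht : t ∈ Icc 0 t₁) (x : ℝ) :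
    ux u x t = ∫ θ in (-L)..L, G' (x - q θ t) * m₀ θ := by
  have hq : Continuous fun θ => q θ t := hc.cont.comp (Continuous.prodMk_left t)
  have hG : ∀ y, Continuous fun θ => G (y - q θ t) * m₀ θ := fun y =>
    (continuous_G.comp (continuous_const.sub hq)).mul hm₀
  have hd := (intervalIntegral.hasDerivAt_integral_of_dominated_loc_of_lip (μ := volume)
    (F := fun y θ => G (y - q θ t) * m₀ θ) (F' := fun θ => G' (x - q θ t) * m₀ θ)
    (x₀ := x) (a := -L) (b := L) (s := univ) (bound := fun θ => |m₀ θ|) univ_mem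
    (Eventually.of_forall fun y => (hG y).aestronglyMeasurable)
    ((hG x).intervalIntegrable _ _)
    ((measurable_G'.comp (measurable_const.sub hq.measurable)).mul
      hm₀.measurable).aestronglyMeasurable ?_ (hm₀.abs.intervalIntegrable _ _) ?_).2
  · refine (h.hasDerivAt_u ⟨ht.1, ht.2.trans_lt ht₁.2⟩ x).unique ?_
    refine hd.congr_of_eventuallyEq (Eventually.of_forall fun y => ?_)
    exact h.u_eq hsupp ht₁ hc ht y
  · refine Eventually.of_forall fun θ _ => LipschitzOnWith.of_dist_le_mul fun y _ z _ => ?_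
    simp only [Real.coe_nnabs, abs_abs, Real.dist_eq]
    rw [← sub_mul, abs_mul, mul_comm]
    refine mul_le_mul_of_nonneg_left ?_ (abs_nonneg _)
    have := abs_G_sub_le (y - q θ t) (z - q θ t)
    rw [sub_sub_sub_cancel_right] at this
    linarith [abs_nonneg (y - z)]
  · -- the kernel is differentiable except at the single label sent to `x`
    obtain ⟨θ₀, hθ₀⟩ := hc.surj t ht x
    filter_upwards [compl_mem_ae_iff.2 (measure_singleton (μ := volume) θ₀)] with θ hθ _
    have hne : x - q θ t ≠ 0 := fun h0 => hθ ((hc.strictMono ht).injective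
      (by simp only at hθ₀ ⊢; linarith))
    have h1 := (hasDerivAt_G hne).comp x ((hasDerivAt_id x).sub_const (q θ t))
    simpa [Function.comp_def] using h1.mul_const (m₀ θ)

end

/-! ### Characteristics and Lagrange dynamics -/

section

variable {L : ℝ} {m₀ : ℝ → ℝ} {T : ℝ} {u m : ℝ → ℝ → ℝ} {t₁ : ℝ} {q J : ℝ → ℝ → ℝ}

theorem abs_integral_mul_le {f : ℝ → ℝ} {c : ℝ} (hL : 0 ≤ L) (hm₀ : Continuous m₀)
    (hf : ∀ θ ∈ Icc (-L) L, |f θ| ≤ c) :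
    |∫ θ in (-L)..L, f θ * m₀ θ| ≤ c * ∫ θ in (-L)..L, |m₀ θ| := by
  rw [← intervalIntegral.integral_const_mul]
  refine intervalIntegral.norm_integral_le_of_norm_le (f := fun θ => f θ * m₀ θ) (by linarith)
    (Eventually.of_forall fun θ hθ => ?_) ((hm₀.abs.intervalIntegrable _ _).const_mul c)
  rw [norm_mul]
  exact mul_le_mul_of_nonneg_right (hf θ (Ioc_subset_Icc_self hθ)) (abs_nonneg _)

/-- Perturbation bound for the squares `(∫ f m₀)²` in the velocity, in the sup norm of `f`. -/
theorem abs_sq_integral_sub_le {f g : ℝ → ℝ} {E : ℝ} (hL : 0 ≤ L) (hm₀ : Continuous m₀)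
    (hf : ∀ θ ∈ Icc (-L) L, |f θ| ≤ 1 / 2) (hg : ∀ θ ∈ Icc (-L) L, |g θ| ≤ 1 / 2)
    (hfg : ∀ θ ∈ Icc (-L) L, |f θ - g θ| ≤ E)
    (hfm : AEStronglyMeasurable f (volume.restrict (Icc (-L) L)))
    (hgm : AEStronglyMeasurable g (volume.restrict (Icc (-L) L))) :
    |(∫ θ in (-L)..L, f θ * m₀ θ) ^ 2 - (∫ θ in (-L)..L, g θ * m₀ θ) ^ 2|
      ≤ E * (∫ θ in (-L)..L, |m₀ θ|) ^ 2 := by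
  have hint : ∀ f : ℝ → ℝ, (∀ θ ∈ Icc (-L) L, |f θ| ≤ 1 / 2) →
      AEStronglyMeasurable f (volume.restrict (Icc (-L) L)) →
      IntervalIntegrable (fun θ => f θ * m₀ θ) volume (-L) L := by
    intro f hf hfm
    rw [intervalIntegrable_iff_integrableOn_Icc_of_le (by linarith)]
    refine Integrable.bdd_mul (c := 1 / 2) (hm₀.continuousOn.integrableOn_Icc) hfm ?_
    exact (ae_restrict_iff' measurableSet_Icc).2 (Eventually.of_forall hf)
  have h1 := abs_integral_mul_le hL hm₀ hf
  have h2 := abs_integral_mul_le hL hm₀ hg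
  have h3 := abs_integral_mul_le hL hm₀ hfg
  simp only [sub_mul] at h3
  rw [intervalIntegral.integral_sub (hint f hf hfm) (hint g hg hgm)] at h3
  rw [sq_sub_sq, abs_mul]
  set A := ∫ θ in (-L)..L, f θ * m₀ θ
  set B := ∫ θ in (-L)..L, g θ * m₀ θ
  set I := ∫ θ in (-L)..L, |m₀ θ|
  have h4 : |A + B| ≤ I := (abs_add_le A B).trans (by linarith)
  calc |A + B| * |A - B| ≤ I * (E * I) :=
        mul_le_mul h4 h3 (abs_nonneg _) ((abs_nonneg _).trans h4)
    _ = _ := by ring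

theorem sign_sub_of_strictMonoOn {Y : ℝ → ℝ} {s : Set ℝ} (hY : StrictMonoOn Y s) {a b : ℝ}
    (ha : a ∈ s) (hb : b ∈ s) : Real.sign (Y a - Y b) = Real.sign (a - b) := by
  rcases lt_trichotomy a b with h | rfl | h
  · rw [Real.sign_of_neg (sub_neg.2 h), Real.sign_of_neg (sub_neg.2 (hY ha hb h))]
  · simp
  · rw [Real.sign_of_pos (sub_pos.2 h), Real.sign_of_pos (sub_pos.2 (hY hb ha h))]

/-- The Lagrange velocity is Lipschitz in the sup norm on order-preserving configurations: the sign
in `G'(Y(ξ) - Y(θ))` then depends on the labels only, so the jump of `G'` is harmless. -/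
theorem abs_velocity_sub_le (hL : 0 ≤ L) (hm₀ : Continuous m₀) {Y Z : ℝ → ℝ → ℝ} {t E : ℝ}
    (hY : ContinuousOn (fun ξ => Y ξ t) (Icc (-L) L))
    (hZ : ContinuousOn (fun ξ => Z ξ t) (Icc (-L) L))
    (hYm : StrictMonoOn (fun ξ => Y ξ t) (Icc (-L) L))
    (hZm : StrictMonoOn (fun ξ => Z ξ t) (Icc (-L) L))
    (hE : ∀ θ ∈ Icc (-L) L, |Y θ t - Z θ t| ≤ E) {ξ : ℝ} (hξ : ξ ∈ Icc (-L) L) :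
    |velocity L m₀ Y (Y ξ t) t - velocity L m₀ Z (Z ξ t) t|
      ≤ 2 * (∫ θ in (-L)..L, |m₀ θ|) ^ 2 * E := by
  have hd : ∀ θ ∈ Icc (-L) L, |G (Y ξ t - Y θ t) - G (Z ξ t - Z θ t)| ≤ E := by
    intro θ hθ
    refine (abs_G_sub_le _ _).trans ?_
    have h1 := hE θ hθ
    have h2 := hE ξ hξ
    have h3 : |Y ξ t - Y θ t - (Z ξ t - Z θ t)| ≤ 2 * E := by
      rw [abs_le] at h1 h2 ⊢
      constructor <;> linarith [h1.1, h1.2, h2.1, h2.2]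
    linarith
  have hm : ∀ Y : ℝ → ℝ → ℝ, ContinuousOn (fun ξ => Y ξ t) (Icc (-L) L) →
      AEMeasurable (fun θ => Y ξ t - Y θ t) (volume.restrict (Icc (-L) L)) := fun Y hY =>
    (continuousOn_const.sub hY).aemeasurable measurableSet_Icc
  have h1 := abs_sq_integral_sub_le hL hm₀ (fun θ _ => abs_G_le (Y ξ t - Y θ t))
    (fun θ _ => abs_G_le (Z ξ t - Z θ t)) hd
    (continuous_G.measurable.comp_aemeasurable (hm Y hY)).aestronglyMeasurable
    (continuous_G.measurable.comp_aemeasurable (hm Z hZ)).aestronglyMeasurable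
  have h2 := abs_sq_integral_sub_le hL hm₀ (fun θ _ => abs_G'_le (Y ξ t - Y θ t))
    (fun θ _ => abs_G'_le (Z ξ t - Z θ t)) (E := E) ?_
    (measurable_G'.comp_aemeasurable (hm Y hY)).aestronglyMeasurable
    (measurable_G'.comp_aemeasurable (hm Z hZ)).aestronglyMeasurable
  · unfold velocity
    rw [abs_le] at h1 h2 ⊢
    constructor <;> linarith [h1.1, h1.2, h2.1, h2.2]
  · intro θ hθ
    have e1 := sign_sub_of_strictMonoOn hYm hξ hθ
    have e2 := sign_sub_of_strictMonoOn hZm hξ hθ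
    beta_reduce at e1 e2
    unfold G'
    rw [e1, e2, ← mul_sub, abs_mul, abs_neg]
    calc _ ≤ 1 * |G (Y ξ t - Y θ t) - G (Z ξ t - Z θ t)| :=
          mul_le_mul_of_nonneg_right (abs_sign_le_one _) (abs_nonneg _)
      _ ≤ E := by simpa using hd θ hθ

variable {X : ℝ → ℝ → ℝ}

theorem IsLagrangeSolution.continuousOn (hX : IsLagrangeSolution L m₀ T X) :
    ContinuousOn (fun z : ℝ × ℝ => X z.1 z.2) (Icc (-L) L ×ˢ Ico 0 T) := by
  simpa using hX.reg.2.2.1 0 (by norm_num)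

theorem IsLagrangeSolution.continuousOn_derivWithin (hX : IsLagrangeSolution L m₀ T X) :
    ContinuousOn (fun z : ℝ × ℝ => derivWithin (fun ξ => X ξ z.2) (Icc (-L) L) z.1)
      (Icc (-L) L ×ˢ Ico 0 T) := by
  refine (hX.reg.2.2.1 1 (by norm_num)).congr fun z hz => ?_
  beta_reduce
  rw [iteratedDerivWithin_one]

theorem IsLagrangeSolution.hasDerivWithinAt (hX : IsLagrangeSolution L m₀ T X) {t : ℝ}
    (ht : t ∈ Ico 0 T) {ξ : ℝ} (hξ : ξ ∈ Icc (-L) L) :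
    HasDerivWithinAt (fun η => X η t) (derivWithin (fun η => X η t) (Icc (-L) L) ξ)
      (Icc (-L) L) ξ :=
  ((hX.reg.1 t ht).differentiableOn (by norm_num) ξ hξ).hasDerivWithinAt

/-- The Lagrange dynamics moves along the characteristics of the classical solution. As long as
both agree, `X_ξ = q_ξ > 0`, so `X` stays order preserving for a short time more, on which the
Lipschitz bound for the velocity forces agreement. -/
theorem IsLagrangeSolution.eq_characteristics (hL : 0 < L) (hm₀ : Continuous m₀)
    (hsupp : tsupport m₀ ⊆ Ioo (-L) L) (h : IsClassicalSolution m₀ T u m) (ht₁ : t₁ ∈ Ico 0 T)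
    (hc : Characteristics m₀ u m t₁ q J) (hX : IsLagrangeSolution L m₀ T X) :
    ∀ t ∈ Icc 0 t₁, ∀ ξ ∈ Icc (-L) L, X ξ t = q ξ t := by
  have hsub : Icc 0 t₁ ⊆ Ico 0 T := fun t ht => ⟨ht.1, ht.2.trans_lt ht₁.2⟩
  have hXc := hX.continuousOn
  have hXt : ∀ ξ ∈ Icc (-L) L, ContinuousOn (X ξ) (Ico 0 T) := fun ξ hξ =>
    hXc.comp (Continuous.prodMk_right ξ).continuousOn fun t ht => ⟨hξ, ht⟩
  have hqξ : ∀ ξ, Continuous (q ξ) := fun ξ => hc.cont.comp (Continuous.prodMk_right ξ)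
  have hqt : ∀ t, Continuous fun ξ => q ξ t := fun t => hc.cont.comp (Continuous.prodMk_left t)
  refine IsClosed.Icc_subset_of_forall_exists_gt
    (s := {t | ∀ ξ ∈ Icc (-L) L, X ξ t = q ξ t}) ?_ ?_ ?_
  · have : {t | ∀ ξ ∈ Icc (-L) L, X ξ t = q ξ t} ∩ Icc 0 t₁
        = ⋂ ξ : Icc (-L) L, Icc 0 t₁ ∩ (fun t => X ξ t - q ξ t) ⁻¹' {0} := by
      ext t
      simp only [mem_inter_iff, mem_ofPred_eq, mem_iInter, mem_preimage, mem_singleton_iff,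
        sub_eq_zero]
      exact ⟨fun H ξ => ⟨H.2, H.1 ξ ξ.2⟩,
        fun H => ⟨fun ξ hξ => (H ⟨ξ, hξ⟩).2, (H ⟨L, by linarith, le_rfl⟩).1⟩⟩
    rw [this]
    exact isClosed_iInter fun ξ => (((hXt ξ ξ.2).mono hsub).sub
      (hqξ ξ).continuousOn).preimage_isClosed_of_isClosed isClosed_Icc isClosed_singleton
  · intro ξ hξ
    rw [hX.initial ξ hξ, hc.initial]
  · rintro t₀ ⟨hagree, ht₀⟩ y hy
    have ht₀T : t₀ ∈ Ico 0 T := hsub (Ico_subset_Icc_self ht₀)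
    -- `X_ξ > 0` for a short time after `t₀`
    have hpos : ∀ᶠ t in 𝓝 t₀, ∀ ξ ∈ Icc (-L) L, (ξ ∈ Icc (-L) L ∧ t ∈ Ico 0 T) →
        0 < derivWithin (fun η => X η t) (Icc (-L) L) ξ := by
      refine isCompact_Icc.eventually_forall_of_forall_eventually fun ξ hξ => ?_
      have h1 : derivWithin (fun η => X η t₀) (Icc (-L) L) ξ = J ξ t₀ := by
        have h2 : HasDerivWithinAt (fun η => X η t₀) (J ξ t₀) (Icc (-L) L) ξ :=
          (hc.hasDerivAt t₀ (Ico_subset_Icc_self ht₀) ξ).hasDerivWithinAt.congr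
            (fun η hη => hagree η hη) (hagree ξ hξ)
        exact h2.derivWithin (uniqueDiffOn_Icc (by linarith) ξ hξ)
      have h3 := (hX.continuousOn_derivWithin (ξ, t₀) ⟨hξ, ht₀T⟩).eventually
        (lt_mem_nhds (show (0 : ℝ) < derivWithin (fun η => X η t₀) (Icc (-L) L) ξ by
          rw [h1]; exact hc.pos ξ t₀))
      rw [eventually_nhdsWithin_iff] at h3
      exact (continuous_swap.tendsto (t₀, ξ)).eventually h3
    set C : ℝ := 2 * (∫ θ in (-L)..L, |m₀ θ|) ^ 2 with hC
    have hC0 : 0 ≤ C := by positivity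
    obtain ⟨ε, hε, hball⟩ := Metric.eventually_nhds_iff.1 hpos
    obtain ⟨t₂, ht₀₂, ht₂⟩ : ∃ t₂, t₀ < t₂ ∧
        t₂ < min (min y t₁) (min (t₀ + ε) (t₀ + 1 / (C + 1))) := by
      apply exists_between
      simp only [lt_min_iff]
      exact ⟨⟨hy, ht₀.2⟩, by linarith, by linarith [show 0 < 1 / (C + 1) by positivity]⟩
    simp only [lt_min_iff] at ht₂
    obtain ⟨⟨hy₂, ht₂₁⟩, htε, htC⟩ := ht₂
    have hsub₂ : Icc t₀ t₂ ⊆ Icc 0 t₁ := Icc_subset_Icc ht₀.1 ht₂₁.le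
    have hXm : ∀ t ∈ Icc t₀ t₂, StrictMonoOn (fun ξ => X ξ t) (Icc (-L) L) := by
      intro t ht
      have htT := hsub (hsub₂ ht)
      refine strictMonoOn_of_hasDerivWithinAt_pos (convex_Icc _ _)
        (fun ξ hξ => (hX.hasDerivWithinAt htT hξ).continuousWithinAt)
        (fun ξ hξ => (hX.hasDerivWithinAt htT (interior_subset hξ)).mono interior_subset)
        (fun ξ hξ => hball ?_ ξ (interior_subset hξ) ⟨interior_subset hξ, htT⟩)
      rw [Real.dist_eq, abs_of_nonneg (sub_nonneg.2 ht.1)]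
      linarith [ht.2]
    refine ⟨t₂, fun ξ hξ => ?_, ht₀₂, hy₂.le⟩
    -- the largest deviation `E` up to time `t₂` satisfies `E ≤ C (t₂ - t₀) E` with `C (t₂ - t₀) < 1`
    obtain ⟨z, hz, hzmax⟩ := (isCompact_Icc.prod isCompact_Icc).exists_isMaxOn
      (s := Icc (-L) L ×ˢ Icc t₀ t₂) (f := fun z : ℝ × ℝ => |X z.1 z.2 - q z.1 z.2|)
      ⟨(ξ, t₀), hξ, le_rfl, ht₀₂.le⟩
      ((hXc.mono (prod_mono_right (hsub₂.trans hsub))).sub hc.cont.continuousOn).abs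
    set E := |X z.1 z.2 - q z.1 z.2| with hE
    have hmax : ∀ ξ ∈ Icc (-L) L, ∀ t ∈ Icc t₀ t₂, |X ξ t - q ξ t| ≤ E := fun ξ hξ t ht =>
      hzmax (show (ξ, t) ∈ _ from ⟨hξ, ht⟩)
    have hE0 : E ≤ 0 := by
      rcases eq_or_lt_of_le hz.2.1 with heq | hlt
      · rw [hE, ← heq, hagree z.1 hz.1]; simp
      obtain ⟨s, hs, hs'⟩ := exists_hasDerivAt_eq_slope (fun s => X z.1 s - q z.1 s)
        (fun s => velocity L m₀ X (X z.1 s) s - velocity L m₀ q (q z.1 s) s) hlt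
        (((hXt z.1 hz.1).mono ((Icc_subset_Icc_right hz.2.2).trans (hsub₂.trans hsub))).sub
          (hqξ z.1).continuousOn)
        (fun s hs => by
          have hsI : s ∈ Ioo 0 t₁ := ⟨ht₀.1.trans_lt hs.1, hs.2.trans_le (hz.2.2.trans ht₂₁.le)⟩
          have h1 := hX.ode z.1 hz.1 s ⟨hsI.1, hsI.2.trans ht₁.2⟩
          have h2 := hc.ode z.1 s hsI
          rw [h.u_eq hsupp ht₁ hc (Ioo_subset_Icc_self hsI),
            h.ux_eq hm₀ hsupp ht₁ hc (Ioo_subset_Icc_self hsI)] at h2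
          exact h1.sub h2)
      have hsI : s ∈ Icc t₀ t₂ := ⟨hs.1.le, hs.2.le.trans hz.2.2⟩
      have hv := abs_velocity_sub_le hL.le hm₀ (Y := X) (Z := q) (t := s)
        (fun ξ hξ => (hX.hasDerivWithinAt (hsub (hsub₂ hsI)) hξ).continuousWithinAt)
        (hqt s).continuousOn (hXm s hsI) ((hc.strictMono (hsub₂ hsI)).strictMonoOn _)
        (fun θ hθ => hmax θ hθ s hsI) hz.1
      rw [hs', hagree z.1 hz.1, sub_self, sub_zero, abs_div, abs_of_pos (sub_pos.2 hlt),
        div_le_iff₀ (sub_pos.2 hlt), ← hE, ← hC] at hv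
      have hE' : 0 ≤ E := abs_nonneg _
      have h5 : z.2 - t₀ ≤ 1 / (C + 1) := by linarith [hz.2.2]
      have h6 : C * E * (z.2 - t₀) ≤ C * E * (1 / (C + 1)) :=
        mul_le_mul_of_nonneg_left h5 (mul_nonneg hC0 hE')
      have h7 : E ≤ C * E / (C + 1) := by rw [div_eq_mul_one_div]; exact hv.trans h6
      rw [le_div_iff₀ (by positivity)] at h7
      linarith
    exact sub_eq_zero.1 (abs_nonpos_iff.1 ((hmax ξ hξ t₂ ⟨ht₀₂.le, le_rfl⟩).trans hE0))

end

/-! ### The flow at the final time -/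

section

variable {L : ℝ} {m₀ : ℝ → ℝ} {T : ℝ} {u m X : ℝ → ℝ → ℝ}

/-- `∂ₜX_ξ = 2 u_x(X, t) m₀(ξ)`, so `X_ξ(ξ, ·)` is Lipschitz with constant `‖m₀‖₁ |m₀(ξ)|`. -/
theorem IsLagrangeSolution.derivWithin_properties (hL : 0 < L) (hm₀ : Continuous m₀)
    (hsupp : tsupport m₀ ⊆ Ioo (-L) L) (h : IsClassicalSolution m₀ T u m)
    (hX : IsLagrangeSolution L m₀ T X) {t : ℝ} (ht : t ∈ Ico 0 T) {ξ : ℝ} (hξ : ξ ∈ Icc (-L) L) :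
    0 < derivWithin (fun η => X η t) (Icc (-L) L) ξ ∧
    ∀ s ∈ Icc 0 t, |derivWithin (fun η => X η t) (Icc (-L) L) ξ
        - derivWithin (fun η => X η s) (Icc (-L) L) ξ|
      ≤ (∫ θ in (-L)..L, |m₀ θ|) * |m₀ ξ| * (t - s) := by
  obtain ⟨q, J, hc⟩ := h.exists_characteristics ht
  have heq := hX.eq_characteristics hL hm₀ hsupp h ht hc
  have hJ : ∀ s ∈ Icc 0 t, derivWithin (fun η => X η s) (Icc (-L) L) ξ = J ξ s := by
    intro s hs
    have h2 : HasDerivWithinAt (fun η => X η s) (J ξ s) (Icc (-L) L) ξ :=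
      (hc.hasDerivAt s hs ξ).hasDerivWithinAt.congr (fun η hη => heq s hs η hη) (heq s hs ξ hξ)
    exact h2.derivWithin (uniqueDiffOn_Icc (by linarith) ξ hξ)
  have htt : t ∈ Icc 0 t := ⟨ht.1, le_rfl⟩
  rw [hJ t htt]
  refine ⟨hc.pos ξ t, fun s hs => ?_⟩
  rw [hJ s hs]
  rcases eq_or_lt_of_le hs.2 with rfl | hst
  · simp
  obtain ⟨r, hr, hr'⟩ := exists_hasDerivAt_eq_slope (J ξ) (fun r => 2 * ux u (q ξ r) r * m₀ ξ) hst
    (hc.contJ.comp (Continuous.prodMk_right ξ)).continuousOn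
    (fun r hr => hc.odeJ ξ r ⟨hs.1.trans_lt hr.1, hr.2⟩)
  have hrI : r ∈ Icc 0 t := ⟨hs.1.trans hr.1.le, hr.2.le⟩
  rw [eq_div_iff (sub_pos.2 hst).ne'] at hr'
  rw [← hr', abs_mul, abs_mul, abs_mul, abs_of_pos (sub_pos.2 hst),
    abs_of_pos (two_pos : (0 : ℝ) < 2)]
  have hux : |ux u (q ξ r) r| ≤ 1 / 2 * ∫ θ in (-L)..L, |m₀ θ| := by
    rw [h.ux_eq hm₀ hsupp ht hc hrI]
    exact abs_integral_mul_le hL.le hm₀ fun θ _ => abs_G'_le _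
  have : 0 ≤ t - s := sub_nonneg.2 hs.2
  gcongr
  linarith

/-- Before the final time, `m(·, t) dx` is the image of `m₀ dξ` under `X(·, t)`. -/
theorem IsLagrangeSolution.integral_mul_m (hL : 0 < L) (hm₀ : Continuous m₀)
    (hsupp : tsupport m₀ ⊆ Ioo (-L) L) (h : IsClassicalSolution m₀ T u m)
    (hX : IsLagrangeSolution L m₀ T X) {t : ℝ} (ht : t ∈ Ico 0 T) (φ : ℝ → ℝ) :
    ∫ x, φ x * m x t = ∫ ξ in (-L)..L, φ (X ξ t) * m₀ ξ := by
  obtain ⟨q, J, hc⟩ := h.exists_characteristics ht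
  have htt : t ∈ Icc 0 t := ⟨ht.1, le_rfl⟩
  have heq := hX.eq_characteristics hL hm₀ hsupp h ht hc t htt
  rw [hc.integral_mul_m htt, integral_mul_eq_intervalIntegral hsupp (fun ξ => φ (q ξ t))]
  refine intervalIntegral.integral_congr fun ξ hξ => ?_
  rw [uIcc_of_le (by linarith)] at hξ
  simp only [heq ξ hξ]

theorem eventually_mem_Ico (hT : 0 < T) : ∀ᶠ t in 𝓝[<] T, t ∈ Ico 0 T := by
  filter_upwards [Ioo_mem_nhdsLT hT] with t ht using Ioo_subset_Ico_self ht

/-- The flow stays `C¹` up to the final time, with label derivative `D` there. A label at which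
`D` vanishes carries nonzero initial datum, as `D = 1` wherever `m₀ = 0`. -/
theorem IsLagrangeSolution.exists_final_deriv (hL : 0 < L) (hm₀ : Continuous m₀)
    (hsupp : tsupport m₀ ⊆ Ioo (-L) L) (hT : 0 < T) (h : IsClassicalSolution m₀ T u m)
    (hX : IsLagrangeSolution L m₀ T X) :
    ∃ D : ℝ → ℝ, ContinuousOn D (Icc (-L) L) ∧ (∀ ξ ∈ Icc (-L) L, 0 ≤ D ξ) ∧
      (∀ ξ ∈ Icc (-L) L, D ξ = 0 → m₀ ξ ≠ 0) ∧
      ∀ ξ ∈ Icc (-L) L, HasDerivWithinAt (fun η => X η T) (D ξ) (Icc (-L) L) ξ := by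
  set I := ∫ θ in (-L)..L, |m₀ θ| with hI
  have hI0 : 0 ≤ I := intervalIntegral.integral_nonneg (by linarith) fun θ _ => abs_nonneg _
  set J : ℝ → ℝ → ℝ := fun ξ t => derivWithin (fun η => X η t) (Icc (-L) L) ξ with hJ
  have hprop : ∀ t ∈ Ico 0 T, ∀ ξ ∈ Icc (-L) L, 0 < J ξ t ∧
      ∀ s ∈ Icc 0 t, |J ξ t - J ξ s| ≤ I * |m₀ ξ| * (t - s) := fun t ht ξ hξ =>
    hX.derivWithin_properties hL hm₀ hsupp h ht hξ
  have hlip : ∀ ξ ∈ Icc (-L) L, LipschitzOnWith (I * |m₀ ξ|).toNNReal (J ξ) (Ico 0 T) := by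
    intro ξ hξ
    refine LipschitzOnWith.of_dist_le_mul fun s hs t ht => ?_
    rw [Real.coe_toNNReal _ (by positivity)]
    rcases le_total s t with hst | hst
    · rw [dist_comm, dist_comm s, Real.dist_eq, Real.dist_eq, abs_of_nonneg (sub_nonneg.2 hst)]
      exact (hprop t ht ξ hξ).2 s ⟨hs.1, hst⟩
    · rw [Real.dist_eq, Real.dist_eq, abs_of_nonneg (sub_nonneg.2 hst)]
      exact (hprop s hs ξ hξ).2 t ⟨ht.1, hst⟩
  -- a Lipschitz extension of `J ξ` to all times supplies the value at the final time
  have hext : ∀ ξ, ∃ g : ℝ → ℝ, ξ ∈ Icc (-L) L →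
      LipschitzWith (I * |m₀ ξ|).toNNReal g ∧ EqOn (J ξ) g (Ico 0 T) := by
    intro ξ
    by_cases hξ : ξ ∈ Icc (-L) L
    · obtain ⟨g, hg⟩ := (hlip ξ hξ).extend_real
      exact ⟨g, fun _ => hg⟩
    · exact ⟨0, fun h => absurd h hξ⟩
  choose g hg using hext
  let D : ℝ → ℝ := fun ξ => g ξ T
  have hJD : ∀ ξ ∈ Icc (-L) L, ∀ t ∈ Ico 0 T, |J ξ t - D ξ| ≤ I * |m₀ ξ| * (T - t) := by
    intro ξ hξ t ht
    have := (hg ξ hξ).1.dist_le_mul t T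
    rw [Real.coe_toNNReal _ (by positivity), Real.dist_eq, dist_comm, Real.dist_eq,
      abs_of_pos (sub_pos.2 ht.2), ← (hg ξ hξ).2 ht] at this
    exact this
  obtain ⟨M, hM⟩ := isCompact_Icc.exists_bound_of_continuousOn
    (s := Icc (-L) L) hm₀.continuousOn
  have hM0 : 0 ≤ M := (norm_nonneg _).trans (hM L ⟨by linarith, le_rfl⟩)
  have hJD' : ∀ ξ ∈ Icc (-L) L, ∀ t ∈ Ico 0 T, |J ξ t - D ξ| ≤ I * M * (T - t) := by
    intro ξ hξ t ht
    refine (hJD ξ hξ t ht).trans ?_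
    have := (sub_pos.2 ht.2).le
    gcongr
    exact hM ξ hξ
  have hJc : ∀ t ∈ Ico 0 T, ContinuousOn (fun ξ => J ξ t) (Icc (-L) L) := fun t ht =>
    hX.continuousOn_derivWithin.comp (Continuous.prodMk_left t).continuousOn fun ξ hξ => ⟨hξ, ht⟩
  have hlim0 : Tendsto (fun t => I * M * (T - t)) (𝓝[<] T) (𝓝 0) := by
    have : Tendsto (fun t => I * M * (T - t)) (𝓝 T) (𝓝 (I * M * (T - T))) :=
      Continuous.tendsto (by fun_prop) T
    rw [sub_self, mul_zero] at this
    exact this.mono_left nhdsWithin_le_nhds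
  have hunif : TendstoUniformlyOn (fun t ξ => J ξ t) D (𝓝[<] T) (Icc (-L) L) := by
    rw [Metric.tendstoUniformlyOn_iff]
    intro ε hε
    filter_upwards [eventually_mem_Ico hT, hlim0.eventually (gt_mem_nhds hε)] with t ht ht' ξ hξ
    rw [dist_comm, Real.dist_eq]
    exact (hJD' ξ hξ t ht).trans_lt ht'
  have hDc : ContinuousOn D (Icc (-L) L) :=
    hunif.continuousOn ((eventually_mem_Ico hT).mono fun t ht => hJc t ht).frequently
  have hJlim : ∀ ξ ∈ Icc (-L) L, Tendsto (fun t => J ξ t) (𝓝[<] T) (𝓝 (D ξ)) := fun ξ hξ =>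
    hunif.tendsto_at hξ
  refine ⟨D, hDc, fun ξ hξ => ?_, fun ξ hξ hD0 hm => ?_, fun ξ hξ => ?_⟩
  · exact ge_of_tendsto (hJlim ξ hξ) ((eventually_mem_Ico hT).mono fun t ht => (hprop t ht ξ hξ).1.le)
  · have h1 := hJD ξ hξ 0 ⟨le_rfl, hT⟩
    have h2 : J ξ 0 = 1 := by
      have : HasDerivWithinAt (fun η => X η 0) 1 (Icc (-L) L) ξ :=
        (hasDerivWithinAt_id ξ _).congr (fun η hη => hX.initial η hη) (hX.initial ξ hξ)
      exact this.derivWithin (uniqueDiffOn_Icc (by linarith) ξ hξ)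
    rw [h2, hD0, hm] at h1
    norm_num at h1
  · -- pass to the limit in the fundamental theorem of calculus
    have hLL : -L ≤ L := by linarith
    let D' : ℝ → ℝ := IccExtend hLL ((Icc (-L) L).domRestrict D)
    have hD'c : Continuous D' := (continuousOn_iff_continuous_domRestrict.1 hDc).Icc_extend'
    have hD' : ∀ ξ ∈ Icc (-L) L, D' ξ = D ξ := fun ξ hξ => IccExtend_of_mem hLL _ hξ
    have hprim : ∀ η ∈ Icc (-L) L, X η T = X (-L) T + ∫ s in (-L)..η, D' s := by
      intro η hη
      have hsubη : Icc (-L) η ⊆ Icc (-L) L := Icc_subset_Icc_right hη.2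
      have e1 : ∀ t ∈ Ico 0 T, X η t - X (-L) t = ∫ s in (-L)..η, J s t := by
        intro t ht
        refine (intervalIntegral.integral_eq_sub_of_hasDerivAt_of_le (f := fun s => X s t) hη.1
          (fun s hs => ((hX.hasDerivWithinAt ht (hsubη hs)).continuousWithinAt).mono hsubη)
          (fun s hs => ?_) ?_).symm
        · exact (hX.hasDerivWithinAt ht (hsubη (Ioo_subset_Icc_self hs))).hasDerivAt
            (Icc_mem_nhds hs.1 (hs.2.trans_le hη.2))
        · exact (ContinuousOn.mono (hJc t ht) (by rw [uIcc_of_le hη.1]; exact hsubη)).intervalIntegrable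
      have e2 : Tendsto (fun t => X η t - X (-L) t) (𝓝[<] T) (𝓝 (X η T - X (-L) T)) :=
        (hX.final η hη).sub (hX.final (-L) ⟨le_rfl, hLL⟩)
      have e3 : Tendsto (fun t => ∫ s in (-L)..η, J s t) (𝓝[<] T) (𝓝 (∫ s in (-L)..η, D' s)) := by
        rw [tendsto_iff_dist_tendsto_zero]
        have hl : Tendsto (fun t => I * M * (T - t) * |η - -L|) (𝓝[<] T) (𝓝 0) := by
          simpa using hlim0.mul_const |η - -L|
        refine squeeze_zero' (Eventually.of_forall fun t => dist_nonneg) ?_ hl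
        filter_upwards [eventually_mem_Ico hT] with t ht
        rw [dist_eq_norm, ← intervalIntegral.integral_sub
          (ContinuousOn.mono (hJc t ht) (by rw [uIcc_of_le hη.1]; exact hsubη)).intervalIntegrable
          (hD'c.intervalIntegrable _ _)]
        refine intervalIntegral.norm_integral_le_of_norm_le_const fun s hs => ?_
        rw [uIoc_of_le hη.1] at hs
        have hs' := hsubη (Ioc_subset_Icc_self hs)
        rw [hD' s hs']
        exact hJD' s hs' t ht
      have e4 := tendsto_nhds_unique (e2.congr' ((eventually_mem_Ico hT).mono e1)) e3
      linarith
    have hder : HasDerivAt (fun η => X (-L) T + ∫ s in (-L)..η, D' s) (D' ξ) ξ :=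
      (intervalIntegral.integral_hasDerivAt_right (hD'c.intervalIntegrable _ _)
        (hD'c.stronglyMeasurableAtFilter _ _) hD'c.continuousAt).const_add _
    rw [← hD' ξ hξ]
    exact hder.hasDerivWithinAt.congr hprim (hprim ξ hξ)

/-- The weak-* limit of `m(·, t) dx` is the image of `m₀ dξ` under `X(·, T)`. -/
theorem IsLagrangeSolution.tendsto_integral_mul_m (hL : 0 < L) (hm₀ : Continuous m₀)
    (hsupp : tsupport m₀ ⊆ Ioo (-L) L) (hT : 0 < T) (h : IsClassicalSolution m₀ T u m)
    (hX : IsLagrangeSolution L m₀ T X) (φ : C₀(ℝ, ℝ)) :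
    Tendsto (fun t => ∫ x, φ x * m x t) (𝓝[<] T)
      (𝓝 (∫ ξ in (-L)..L, φ (X ξ T) * m₀ ξ)) := by
  have hLL : -L ≤ L := by linarith
  have hlim : Tendsto (fun t => ∫ ξ in (-L)..L, φ (X ξ t) * m₀ ξ) (𝓝[<] T)
      (𝓝 (∫ ξ in (-L)..L, φ (X ξ T) * m₀ ξ)) := by
    refine intervalIntegral.tendsto_integral_filter_of_dominated_convergence
      (fun ξ => ‖φ.toBCF‖ * |m₀ ξ|) ?_ ?_ ((hm₀.abs.intervalIntegrable _ _).const_mul _) ?_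
    · filter_upwards [eventually_mem_Ico hT] with t ht
      have : ContinuousOn (fun ξ => φ (X ξ t) * m₀ ξ) (Icc (-L) L) :=
        (φ.continuous.comp_continuousOn
          (fun ξ hξ => (hX.hasDerivWithinAt ht hξ).continuousWithinAt)).mul hm₀.continuousOn
      rw [uIoc_of_le hLL]
      exact (this.mono Ioc_subset_Icc_self).aestronglyMeasurable measurableSet_Ioc
    · refine Eventually.of_forall fun t => Eventually.of_forall fun ξ _ => ?_
      rw [norm_mul]
      exact mul_le_mul_of_nonneg_right (φ.toBCF.norm_coe_le_norm _) (abs_nonneg _)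
    · refine Eventually.of_forall fun ξ hξ => ?_
      rw [uIoc_of_le hLL] at hξ
      exact ((φ.continuous.tendsto _).comp (hX.final ξ (Ioc_subset_Icc_self hξ))).mul_const _
  refine hlim.congr' ?_
  filter_upwards [eventually_mem_Ico hT] with t ht
  exact (hX.integral_mul_m hL hm₀ hsupp h ht φ).symm

end

/-! ### Signed measures as functionals on `C₀` -/

theorem integrable_of_isFiniteMeasure (φ : C₀(ℝ, ℝ)) (μ : Measure ℝ) [IsFiniteMeasure μ] :
    Integrable φ μ := φ.toBCF.integrable μ

theorem integrable_signedMeasure (φ : C₀(ℝ, ℝ)) (ν : SignedMeasure ℝ) :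
    VectorMeasure.Integrable ν φ := by
  have : IsFiniteMeasure ν.variation := by
    rw [← SignedMeasure.totalVariation_eq_variation]
    unfold SignedMeasure.totalVariation
    infer_instance
  exact integrable_of_isFiniteMeasure φ _

theorem integral_toSignedMeasure_sub (φ : C₀(ℝ, ℝ)) (μ ν : Measure ℝ) [IsFiniteMeasure μ]
    [IsFiniteMeasure ν] :
    ∫ᵛ x, φ x ∂<•(μ.toSignedMeasure - ν.toSignedMeasure) = ∫ x, φ x ∂μ - ∫ x, φ x ∂ν := by
  rw [VectorMeasure.integral_sub_vectorMeasure (integrable_signedMeasure φ _)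
    (integrable_signedMeasure φ _), VectorMeasure.integral_toSignedMeasure,
    VectorMeasure.integral_toSignedMeasure]

theorem integral_signedMeasure (φ : C₀(ℝ, ℝ)) (ν : SignedMeasure ℝ) :
    ∫ᵛ x, φ x ∂<•ν = ∫ x, φ x ∂ν.toJordanDecomposition.posPart
      - ∫ x, φ x ∂ν.toJordanDecomposition.negPart := by
  rw [← integral_toSignedMeasure_sub]
  conv_lhs => rw [← ν.toSignedMeasure_toJordanDecomposition]
  rfl

theorem integral_withDensityᵥ (φ : C₀(ℝ, ℝ)) {f : ℝ → ℝ} (hf : Integrable f) :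
    ∫ᵛ x, φ x ∂<•(volume.withDensityᵥ f) = ∫ x, φ x * f x := by
  have h1 := isFiniteMeasure_withDensity_ofReal hf.2
  have h2 := isFiniteMeasure_withDensity_ofReal hf.neg.2
  have key : ∀ g : ℝ → ℝ, Integrable g →
      ∫ x, φ x ∂(volume.withDensity fun x => ENNReal.ofReal (g x)) = ∫ x, φ x * max (g x) 0 := by
    intro g hg
    rw [integral_withDensity_eq_integral_toReal_smul₀ hg.aemeasurable.ennreal_ofReal
      (Eventually.of_forall fun x => ENNReal.ofReal_lt_top)]
    simp only [ENNReal.toReal_ofReal', smul_eq_mul, mul_comm]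
  have hint : ∀ g : ℝ → ℝ, Integrable g → Integrable fun x => φ x * max (g x) 0 := fun g hg =>
    (hg.pos_part).bdd_mul φ.continuous.aestronglyMeasurable
      (Eventually.of_forall fun x => φ.toBCF.norm_coe_le_norm x)
  rw [withDensityᵥ_eq_withDensity_pos_part_sub_withDensity_neg_part hf,
    integral_toSignedMeasure_sub φ, key f hf, key (fun x => -f x) hf.neg,
    ← integral_sub (hint f hf) (hint (fun x => -f x) hf.neg)]
  refine integral_congr_ae (Eventually.of_forall fun x => ?_)
  simp only
  rw [← mul_sub, max_zero_sub_max_neg_zero_eq_self]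

/-- A finite signed measure on the line is determined by its action on `C₀`. -/
theorem signedMeasure_ext_of_integral {μ ν : SignedMeasure ℝ}
    (h : ∀ φ : C₀(ℝ, ℝ), ∫ᵛ x, φ x ∂<•μ = ∫ᵛ x, φ x ∂<•ν) : μ = ν := by
  -- adding the negative parts turns the claim into one about positive measures
  have key : μ.toJordanDecomposition.posPart + ν.toJordanDecomposition.negPart
      = ν.toJordanDecomposition.posPart + μ.toJordanDecomposition.negPart := by
    refine Measure.ext_of_integral_eq_on_compactlySupported fun f => ?_
    let φ : C₀(ℝ, ℝ) := ⟨f.toContinuousMap, f.hasCompactSupport.is_zero_at_infty⟩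
    have h1 := h φ
    rw [integral_signedMeasure, integral_signedMeasure] at h1
    have e : ∀ ρ : Measure ℝ, ∫ x, φ x ∂ρ = ∫ x, f x ∂ρ := fun ρ => rfl
    have hi : ∀ (ρ : Measure ℝ) [IsFiniteMeasure ρ], Integrable (fun x => f x) ρ := fun ρ _ =>
      integrable_of_isFiniteMeasure φ ρ
    simp only [e] at h1
    rw [integral_add_measure (hi _) (hi _), integral_add_measure (hi _) (hi _)]
    linarith
  ext s hs
  rw [μ.apply_eq_posPart_real_sub_negPart_real hs, ν.apply_eq_posPart_real_sub_negPart_real hs]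
  have := congrArg (fun ρ : Measure ℝ => ρ.real s) key
  rw [measureReal_add_apply, measureReal_add_apply] at this
  linarith

theorem IsWeakStarLimit.unique {m : ℝ → ℝ → ℝ} {T : ℝ} {μ ν : SignedMeasure ℝ}
    (hμ : IsWeakStarLimit m T μ) (hν : IsWeakStarLimit m T ν) : μ = ν :=
  signedMeasure_ext_of_integral fun φ => tendsto_nhds_unique (hμ φ) (hν φ)

theorem integral_withDensityᵥ_add_sum_dirac (φ : C₀(ℝ, ℝ)) {f : ℝ → ℝ} (hf : Integrable f)
    {ι : Type*} [Fintype ι] (x p : ι → ℝ) :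
    ∫ᵛ y, φ y ∂<•(volume.withDensityᵥ f + ∑ i, VectorMeasure.dirac (x i) (p i))
      = (∫ y, φ y * f y) + ∑ i, φ (x i) * p i := by
  rw [VectorMeasure.integral_add_vectorMeasure (integrable_signedMeasure φ _)
    (integrable_signedMeasure φ _), integral_withDensityᵥ φ hf,
    VectorMeasure.integral_finsetSum_vectorMeasure fun i _ => integrable_signedMeasure φ _]
  congr 1
  refine Finset.sum_congr rfl fun i _ => ?_
  rw [VectorMeasure.integral_dirac]
  simp [mul_comm]

theorem withDensityᵥ_add_sum_dirac_apply {f : ℝ → ℝ} (hf : Integrable f)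
    {ι : Type*} [Fintype ι] (x p : ι → ℝ) {A : Set ℝ} (hA : MeasurableSet A) :
    (volume.withDensityᵥ f + ∑ i, VectorMeasure.dirac (x i) (p i)) A
      = (∫ y in A, f y) + ∑ i, A.indicator (fun _ => p i) (x i) := by
  rw [_root_.add_apply, withDensityᵥ_apply hf hA, _root_.sum_apply]
  congr 1
  refine Finset.sum_congr rfl fun i _ => ?_
  by_cases h : x i ∈ A
  · rw [VectorMeasure.dirac_apply_of_mem hA h, indicator_of_mem h]
  · rw [VectorMeasure.dirac_apply_of_notMem h, indicator_of_notMem h]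

/-! ### Monotone profiles and images of densities under them -/

/-- By the mean value theorem for integrals. -/
theorem intervalIntegral_ne_zero {f : ℝ → ℝ} (hf : Continuous f) {a b : ℝ} (hab : a < b)
    (h : ∀ ξ ∈ Icc a b, f ξ ≠ 0) : ∫ ξ in a..b, f ξ ≠ 0 := by
  intro h0
  have hd : ∀ x, HasDerivAt (fun x => ∫ ξ in a..x, f ξ) (f x) x := fun x =>
    intervalIntegral.integral_hasDerivAt_right (hf.intervalIntegrable _ _)
      (hf.stronglyMeasurableAtFilter _ _) hf.continuousAt
  obtain ⟨c, hc, hc'⟩ := exists_hasDerivAt_eq_slope _ f hab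
    (fun x _ => (hd x).continuousAt.continuousWithinAt) (fun x _ => hd x)
  simp only [h0, intervalIntegral.integral_same, sub_zero, zero_div] at hc'
  exact h c (Ioo_subset_Icc_self hc) hc'

/-- A `C¹` nondecreasing map `Y` of `[-L, L]` into the line, with derivative `D`. -/
structure IsMonotoneProfile (L : ℝ) (Y D : ℝ → ℝ) : Prop where
  contD : ContinuousOn D (Icc (-L) L)
  nonneg : ∀ ξ ∈ Icc (-L) L, 0 ≤ D ξ
  hasDeriv : ∀ ξ ∈ Icc (-L) L, HasDerivWithinAt Y (D ξ) (Icc (-L) L) ξ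

/-- The labels in `(-L, L)` at which a profile with derivative `D` is nondegenerate. -/
def regularLabels (L : ℝ) (D : ℝ → ℝ) : Set ℝ := {ξ ∈ Ioo (-L) L | 0 < D ξ}

namespace IsMonotoneProfile

variable {L : ℝ} {Y D : ℝ → ℝ}

theorem continuousOn (h : IsMonotoneProfile L Y D) : ContinuousOn Y (Icc (-L) L) :=
  fun ξ hξ => (h.hasDeriv ξ hξ).continuousWithinAt

theorem hasDerivAt (h : IsMonotoneProfile L Y D) {ξ : ℝ} (hξ : ξ ∈ Ioo (-L) L) :
    HasDerivAt Y (D ξ) ξ :=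
  (h.hasDeriv ξ (Ioo_subset_Icc_self hξ)).hasDerivAt (Icc_mem_nhds hξ.1 hξ.2)

theorem monotoneOn (h : IsMonotoneProfile L Y D) : MonotoneOn Y (Icc (-L) L) :=
  monotoneOn_of_hasDerivWithinAt_nonneg (convex_Icc _ _) h.continuousOn
    (fun ξ hξ => (h.hasDeriv ξ (interior_subset hξ)).mono interior_subset)
    (fun ξ hξ => h.nonneg ξ (interior_subset hξ))

/-- A profile is constant, hence degenerate, between two labels with the same image. -/
theorem deriv_eq_zero (h : IsMonotoneProfile L Y D) {a b : ℝ} (ha : a ∈ Icc (-L) L)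
    (hb : b ∈ Icc (-L) L) (hab : a < b) (hY : Y a = Y b) {ξ : ℝ} (hξ : ξ ∈ Icc a b) :
    D ξ = 0 := by
  have hsub : Icc a b ⊆ Icc (-L) L := Icc_subset_Icc ha.1 hb.2
  have hconst : ∀ η ∈ Icc a b, Y η = Y a := fun η hη =>
    le_antisymm (hY ▸ h.monotoneOn (hsub hη) hb hη.2) (h.monotoneOn ha (hsub hη) hη.1)
  have h1 := (h.hasDeriv ξ (hsub hξ)).mono hsub
  have h2 : HasDerivWithinAt Y 0 (Icc a b) ξ :=
    (hasDerivWithinAt_const ξ (Icc a b) (Y a)).congr hconst (hconst ξ hξ)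
  exact (uniqueDiffOn_Icc hab ξ hξ).eq_deriv _ h1 h2

theorem eq_of_pos (h : IsMonotoneProfile L Y D) {ξ η : ℝ} (hξ : ξ ∈ Icc (-L) L)
    (hη : η ∈ Icc (-L) L) (hD : 0 < D ξ) (hY : Y η = Y ξ) : η = ξ := by
  rcases lt_trichotomy η ξ with hlt | heq | hlt
  · exact absurd (h.deriv_eq_zero hη hξ hlt hY (right_mem_Icc.2 hlt.le)) hD.ne'
  · exact heq
  · exact absurd (h.deriv_eq_zero hξ hη hlt hY.symm (left_mem_Icc.2 hlt.le)) hD.ne'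

theorem regularLabels_subset : regularLabels L D ⊆ Icc (-L) L :=
  fun _ hξ => Ioo_subset_Icc_self hξ.1

theorem injOn (h : IsMonotoneProfile L Y D) : InjOn Y (regularLabels L D) :=
  fun _ hξ _ hη hY => h.eq_of_pos (regularLabels_subset hη) (regularLabels_subset hξ) hη.2 hY

theorem isOpen_regularLabels (h : IsMonotoneProfile L Y D) : IsOpen (regularLabels L D) :=
  (h.contD.mono Ioo_subset_Icc_self).isOpen_inter_preimage isOpen_Ioo isOpen_Ioi

theorem collisionSet_eq (h : IsMonotoneProfile L Y D) (hL : 0 < L) :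
    collisionSet L Y = Y '' {ξ ∈ Icc (-L) L | D ξ = 0} := by
  unfold collisionSet
  congr 1
  ext ξ
  refine and_congr_right fun hξ => ⟨fun h0 => ?_, fun h0 => h0 ▸ h.hasDeriv ξ hξ⟩
  exact (uniqueDiffOn_Icc (by linarith) ξ hξ).eq_deriv _ (h.hasDeriv ξ hξ) h0

theorem regularSet_eq (h : IsMonotoneProfile L Y D) :
    regularSet L Y = Y '' regularLabels L D := by
  unfold regularSet regularLabels
  congr 1
  ext ξ
  refine and_congr_right fun hξ => ⟨fun ⟨d, hd, hd'⟩ => ?_, fun h0 => ⟨D ξ, h0, h.hasDerivAt hξ⟩⟩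
  rwa [(h.hasDerivAt hξ).unique hd']

/-- On the regular labels a profile is an open map. -/
theorem image_mem_nhds (h : IsMonotoneProfile L Y D) {ξ : ℝ} (hξ : ξ ∈ regularLabels L D)
    {U : Set ℝ} (hU : U ∈ 𝓝 ξ) : Y '' (U ∩ regularLabels L D) ∈ 𝓝 (Y ξ) := by
  obtain ⟨ε, hε, hsub⟩ := Metric.nhds_basis_closedBall.mem_iff.1
    (inter_mem hU (h.isOpen_regularLabels.mem_nhds hξ))
  rw [Real.closedBall_eq_Icc] at hsub
  have h1 : ξ - ε ∈ regularLabels L D := (hsub ⟨le_rfl, by linarith⟩).2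
  have h2 : ξ + ε ∈ regularLabels L D := (hsub ⟨by linarith, le_rfl⟩).2
  have hlt : ∀ {a b}, a ∈ regularLabels L D → b ∈ regularLabels L D → a < b → Y a < Y b :=
    fun ha hb hab => lt_of_le_of_ne
      (h.monotoneOn (regularLabels_subset ha) (regularLabels_subset hb) hab.le)
      fun he => hab.ne (h.injOn ha hb he)
  refine mem_of_superset (Icc_mem_nhds (hlt h1 hξ (by linarith)) (hlt hξ h2 (by linarith))) ?_
  refine (intermediate_value_Icc (by linarith) (h.continuousOn.mono ?_)).trans (image_mono hsub)
  exact fun η hη => regularLabels_subset (hsub hη).2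

theorem isOpen_regularSet (h : IsMonotoneProfile L Y D) : IsOpen (regularSet L Y) := by
  rw [h.regularSet_eq, isOpen_iff_mem_nhds]
  rintro _ ⟨ξ, hξ, rfl⟩
  exact mem_of_superset (h.image_mem_nhds hξ univ_mem) (image_mono inter_subset_right)

end IsMonotoneProfile

/-- The density on the regular set of the image of `m₀ dξ` under a profile `Y` with derivative
`D`, namely `m₀ / D` at the label of the point, extended by zero. -/
def pushDensity (L : ℝ) (Y D m₀ : ℝ → ℝ) : ℝ → ℝ :=
  (regularSet L Y).indicator fun y =>
    m₀ (Function.invFunOn Y (regularLabels L D) y) / D (Function.invFunOn Y (regularLabels L D) y)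

namespace IsMonotoneProfile

variable {L : ℝ} {Y D m₀ : ℝ → ℝ}

theorem invFunOn_apply (h : IsMonotoneProfile L Y D) {ξ : ℝ} (hξ : ξ ∈ regularLabels L D) :
    Function.invFunOn Y (regularLabels L D) (Y ξ) = ξ := h.injOn.leftInvOn_invFunOn hξ

theorem pushDensity_apply (h : IsMonotoneProfile L Y D) {ξ : ℝ} (hξ : ξ ∈ regularLabels L D) :
    pushDensity L Y D m₀ (Y ξ) = m₀ ξ / D ξ := by
  have : Y ξ ∈ regularSet L Y := h.regularSet_eq ▸ mem_image_of_mem Y hξ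
  rw [pushDensity, indicator_of_mem this, h.invFunOn_apply hξ]

theorem continuousOn_pushDensity (h : IsMonotoneProfile L Y D) (hm₀ : Continuous m₀) :
    ContinuousOn (pushDensity L Y D m₀) (regularSet L Y) := by
  have hinv : ContinuousOn (Function.invFunOn Y (regularLabels L D)) (regularSet L Y) := by
    rw [h.regularSet_eq]
    rintro _ ⟨ξ, hξ, rfl⟩
    refine ContinuousAt.continuousWithinAt fun U hU => ?_
    rw [h.invFunOn_apply hξ] at hU
    refine mem_map.2 (mem_of_superset (h.image_mem_nhds hξ hU) ?_)
    rintro _ ⟨η, hη, rfl⟩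
    rw [mem_preimage, h.invFunOn_apply hη.2]
    exact hη.1
  have hmaps : MapsTo (Function.invFunOn Y (regularLabels L D)) (regularSet L Y)
      (regularLabels L D) := by
    rw [h.regularSet_eq]
    exact fun y hy => Function.invFunOn_mem hy
  refine ContinuousOn.congr ?_ fun y hy => indicator_of_mem hy _
  refine (hm₀.comp_continuousOn hinv).div
    ((h.contD.mono regularLabels_subset).comp hinv hmaps) fun y hy => (hmaps hy).2.ne'

theorem integrable_pushDensity (h : IsMonotoneProfile L Y D) (hm₀ : Continuous m₀) :
    Integrable (pushDensity L Y D m₀) := by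
  have hS := h.isOpen_regularLabels.measurableSet
  have h1 : IntegrableOn (pushDensity L Y D m₀) (Y '' regularLabels L D) := by
    rw [integrableOn_image_iff_integrableOn_deriv_smul_of_monotoneOn hS
      (fun ξ hξ => (h.hasDerivAt hξ.1).hasDerivWithinAt) (h.monotoneOn.mono regularLabels_subset)]
    refine IntegrableOn.congr_fun (f := m₀)
      ((hm₀.continuousOn.integrableOn_Icc).mono_set regularLabels_subset) (fun ξ hξ => ?_) hS
    rw [h.pushDensity_apply hξ, smul_eq_mul, mul_div_cancel₀ _ hξ.2.ne']
  rw [← h.regularSet_eq] at h1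
  rw [pushDensity] at h1 ⊢
  rw [← integrable_indicator_iff h.isOpen_regularSet.measurableSet] at h1
  rwa [indicator_indicator, inter_self] at h1

theorem integral_mul_pushDensity (h : IsMonotoneProfile L Y D) (φ : ℝ → ℝ) :
    ∫ y, φ y * pushDensity L Y D m₀ y = ∫ ξ in regularLabels L D, φ (Y ξ) * m₀ ξ := by
  have hS := h.isOpen_regularLabels.measurableSet
  have h1 : ∫ y, φ y * pushDensity L Y D m₀ y
      = ∫ y in Y '' regularLabels L D, φ y * pushDensity L Y D m₀ y := by
    refine (setIntegral_eq_integral_of_forall_compl_eq_zero fun y hy => ?_).symm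
    rw [← h.regularSet_eq] at hy
    rw [pushDensity, indicator_of_notMem hy, mul_zero]
  rw [h1, integral_image_eq_integral_deriv_smul_of_monotoneOn hS
    (fun ξ hξ => (h.hasDerivAt hξ.1).hasDerivWithinAt) (h.monotoneOn.mono regularLabels_subset)]
  refine setIntegral_congr_fun hS fun ξ hξ => ?_
  have := hξ.2.ne'
  simp only [smul_eq_mul]
  rw [h.pushDensity_apply hξ]
  field_simp

/-- The labels of a point form a compact interval, which is degenerate outside the interval
collision set. -/
theorem labels_subsingleton (h : IsMonotoneProfile L Y D) {x : ℝ} (hx : x ∈ collisionSet L Y)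
    (hx' : x ∉ intervalCollisionSet L Y) : (labels L Y x).Subsingleton := by
  rcases (labels L Y x).eq_empty_or_nonempty with he | hne
  · rw [he]; exact subsingleton_empty
  have hord : (labels L Y x).OrdConnected := by
    refine ⟨fun a ha b hb c hc => ?_⟩
    have hcI : c ∈ Icc (-L) L := ⟨ha.1.1.trans hc.1, hc.2.trans hb.1.2⟩
    exact ⟨hcI, le_antisymm (hb.2 ▸ h.monotoneOn hcI hb.1 hc.2)
      (ha.2 ▸ h.monotoneOn ha.1 hcI hc.1)⟩
  have hcomp : IsCompact (labels L Y x) :=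
    isCompact_Icc.of_isClosed_subset
      (h.continuousOn.preimage_isClosed_of_isClosed isClosed_Icc isClosed_singleton)
      fun ξ hξ => hξ.1
  have heq := eq_Icc_of_connected_compact ⟨hne, hord.isPreconnected⟩ hcomp
  by_contra hns
  refine hx' ⟨hx, _, _, ?_, heq⟩
  by_contra hle
  apply hns
  rw [heq]
  exact subsingleton_Icc_of_ge (not_lt.1 hle)

/-- If only finitely many points are collision points, then up to a null set the labels split into
the regular ones and the collapsed intervals. -/
theorem integral_eq_add_sum (h : IsMonotoneProfile L Y D) (hL : 0 < L) (hm₀ : Continuous m₀)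
    {ι κ : Type*} [Fintype ι] [Finite κ] {x : ι → ℝ} {z : κ → ℝ}
    (hx : Function.Injective x) (hF : collisionSet L Y = range z)
    (hFhat : intervalCollisionSet L Y = range x)
    {a b : ι → ℝ} (hab : ∀ i, labels L Y (x i) = Icc (a i) (b i)) (hlt : ∀ i, a i < b i)
    {φ : ℝ → ℝ} (hφ : Continuous φ) :
    ∫ ξ in (-L)..L, φ (Y ξ) * m₀ ξ
      = (∫ ξ in regularLabels L D, φ (Y ξ) * m₀ ξ)
        + ∑ i, φ (x i) * ∫ ξ in (a i)..(b i), m₀ ξ := by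
  have hI : IntegrableOn (fun ξ => φ (Y ξ) * m₀ ξ) (Icc (-L) L) :=
    ((hφ.comp_continuousOn h.continuousOn).mul hm₀.continuousOn).integrableOn_Icc
  have hsub : ∀ i, Icc (a i) (b i) ⊆ Icc (-L) L := fun i ξ hξ => ((hab i) ▸ hξ :
    ξ ∈ labels L Y (x i)).1
  have hval : ∀ i, ∀ ξ ∈ Icc (a i) (b i), Y ξ = x i := fun i ξ hξ => ((hab i) ▸ hξ :
    ξ ∈ labels L Y (x i)).2
  have hD0 : ∀ i, ∀ ξ ∈ Icc (a i) (b i), D ξ = 0 := fun i ξ hξ =>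
    h.deriv_eq_zero (hsub i (left_mem_Icc.2 (hlt i).le)) (hsub i (right_mem_Icc.2 (hlt i).le))
      (hlt i) (by rw [hval i _ (left_mem_Icc.2 (hlt i).le), hval i _ (right_mem_Icc.2 (hlt i).le)]) hξ
  have hS := h.isOpen_regularLabels.measurableSet
  -- the exceptional labels: the two end points and isolated preimages of collision points
  let R : Set ℝ := {-L, L} ∪ ⋃ j : κ, {ξ ∈ labels L Y (z j) | (labels L Y (z j)).Subsingleton}
  have hR : R.Finite := by
    refine (toFinite _).union (finite_iUnion fun j => ?_)
    exact Subsingleton.finite fun ξ hξ η hη => hξ.2 hξ.1 hη.1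
  have hae : (Icc (-L) L : Set ℝ) =ᵐ[volume]
      (regularLabels L D ∪ ⋃ i, Icc (a i) (b i) : Set ℝ) := by
    have hsub' : regularLabels L D ∪ ⋃ i, Icc (a i) (b i) ⊆ Icc (-L) L :=
      union_subset regularLabels_subset (iUnion_subset hsub)
    refine (hsub'.eventuallyLE.antisymm ?_).symm
    rw [ae_le_set]
    refine measure_mono_null (t := R) ?_ (hR.measure_zero _)
    rintro ξ ⟨hξ, hn⟩
    simp only [mem_union, mem_iUnion, not_or, not_exists] at hn
    by_cases hend : ξ ∈ Ioo (-L) L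
    · have hDξ : D ξ = 0 := le_antisymm (not_lt.1 fun hp => hn.1 ⟨hend, hp⟩) (h.nonneg ξ hξ)
      have hc : Y ξ ∈ collisionSet L Y := by
        rw [h.collisionSet_eq hL]; exact ⟨ξ, ⟨hξ, hDξ⟩, rfl⟩
      have hnot : Y ξ ∉ intervalCollisionSet L Y := by
        rw [hFhat]
        rintro ⟨i, hi⟩
        exact hn.2 i (hab i ▸ ⟨hξ, hi.symm⟩)
      have hss := h.labels_subsingleton hc hnot
      obtain ⟨j, hj⟩ := hF ▸ hc
      refine Or.inr (mem_iUnion.2 ⟨j, ?_⟩)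
      rw [hj]
      exact ⟨⟨hξ, rfl⟩, hss⟩
    · left
      rcases eq_or_lt_of_le hξ.1 with h1 | h1
      · exact Or.inl h1.symm
      · rcases eq_or_lt_of_le hξ.2 with h2 | h2
        · exact Or.inr h2
        · exact absurd ⟨h1, h2⟩ hend
  have hdisj : Disjoint (regularLabels L D) (⋃ i, Icc (a i) (b i)) := by
    refine disjoint_left.2 fun ξ hξ hξ' => ?_
    obtain ⟨i, hi⟩ := mem_iUnion.1 hξ'
    exact hξ.2.ne' (hD0 i ξ hi)
  have hpair : Pairwise (Function.onFun Disjoint fun i => Icc (a i) (b i)) := by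
    intro i j hij
    refine disjoint_left.2 fun ξ hi hj => hij (hx ?_)
    rw [← hval i ξ hi, ← hval j ξ hj]
  rw [intervalIntegral.integral_of_le (by linarith), ← integral_Icc_eq_integral_Ioc,
    setIntegral_congr_set hae, setIntegral_union hdisj (MeasurableSet.iUnion fun i => measurableSet_Icc)
      (hI.mono_set regularLabels_subset) (hI.mono_set (iUnion_subset hsub)),
    integral_iUnion_fintype (fun i => measurableSet_Icc) hpair (fun i => hI.mono_set (hsub i))]
  congr 1
  refine Finset.sum_congr rfl fun i _ => ?_
  rw [intervalIntegral.integral_of_le (hlt i).le, ← integral_Icc_eq_integral_Ioc,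
    ← integral_const_mul]
  exact setIntegral_congr_fun measurableSet_Icc fun ξ hξ => by simp only [hval i ξ hξ]

end IsMonotoneProfile

end MCH

end

theorem theorem1p3 (L : ℝ) (hL : 0 < L) (m₀ : ℝ → ℝ) (hm₀ : ContDiff ℝ 1 m₀)
    (hsupp : tsupport m₀ ⊆ Ioo (-L) L)
    (T : ℝ) (hT : 0 < T) (u m : ℝ → ℝ → ℝ) (hum : MCH.IsMaximalClassicalSolution m₀ T u m)
    (X : ℝ → ℝ → ℝ) (hX : MCH.IsLagrangeSolution L m₀ T X)
    (N N₁ : ℕ) (hN : N ≤ N₁) (x : Fin N₁ → ℝ) (hx : Function.Injective x)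
    (hF : MCH.collisionSet L (fun ξ => X ξ T) = range x)
    (hFhat : MCH.intervalCollisionSet L (fun ξ => X ξ T)
      = range (fun i : Fin N => x (Fin.castLE hN i)))
    (a b : Fin N → ℝ)
    (hab : ∀ i : Fin N, MCH.labels L (fun ξ => X ξ T) (x (Fin.castLE hN i)) = Icc (a i) (b i))
    (p : Fin N → ℝ) (hp : ∀ i : Fin N, p i = ∫ ξ in (a i)..(b i), m₀ ξ) :
    -- `mT` is the measure `m(·, T)`, the unique weak-* limit of `m(·, t)` as `t ↑ T`
    ∃ mT : SignedMeasure ℝ,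
      MCH.IsWeakStarLimit m T mT ∧
      (∀ ν : SignedMeasure ℝ, MCH.IsWeakStarLimit m T ν → ν = mT) ∧
      IsOpen (MCH.regularSet L (fun ξ => X ξ T)) ∧
      -- `m₁` equals `m(·, T)` (a continuous function there) on `O_T` and vanishes elsewhere
      (∃ m₁ : ℝ → ℝ,
        Integrable m₁ ∧
        ContinuousOn m₁ (MCH.regularSet L (fun ξ => X ξ T)) ∧
        (∀ A : Set ℝ, MeasurableSet A → A ⊆ MCH.regularSet L (fun ξ => X ξ T) →
          mT A = ∫ y in A, m₁ y) ∧
        (∀ y, y ∉ MCH.regularSet L (fun ξ => X ξ T) → m₁ y = 0) ∧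
        mT = volume.withDensityᵥ m₁
          + ∑ i : Fin N, VectorMeasure.dirac (x (Fin.castLE hN i)) (p i)) ∧
      (∀ i : Fin N, p i ≠ 0) ∧
      -- the point masses of `m(·, T)` sit exactly at the collapsed intervals of labels
      (∀ y : ℝ, mT {y} ≠ 0 ↔ y ∈ MCH.intervalCollisionSet L (fun ξ => X ξ T)) := by
  have hmc := hm₀.continuous
  obtain ⟨D, hDc, hD0, hDm, hDd⟩ := hX.exists_final_deriv hL hmc hsupp hT hum.1
  set Y : ℝ → ℝ := fun ξ => X ξ T with hY
  have hprof : MCH.IsMonotoneProfile L Y D := ⟨hDc, hD0, hDd⟩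
  set x' : Fin N → ℝ := fun i => x (Fin.castLE hN i) with hx'
  have hx'inj : Function.Injective x' := hx.comp (Fin.castLE_injective hN)
  have hlt : ∀ i, a i < b i := by
    intro i
    have hi : x' i ∈ MCH.intervalCollisionSet L Y := hFhat ▸ mem_range_self i
    obtain ⟨-, ξ₁, ξ₂, h12, he⟩ := hi
    rw [hab i] at he
    have h1 : ξ₁ ∈ Icc (a i) (b i) := he ▸ left_mem_Icc.2 h12.le
    have h2 : ξ₂ ∈ Icc (a i) (b i) := he ▸ right_mem_Icc.2 h12.le
    exact h1.1.trans_lt (h12.trans_le h2.2)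
  have hmem : ∀ i, ∀ ξ ∈ Icc (a i) (b i), ξ ∈ Icc (-L) L ∧ Y ξ = x' i := fun i ξ hξ =>
    (hab i ▸ hξ : ξ ∈ MCH.labels L Y (x' i))
  have hDab : ∀ i, ∀ ξ ∈ Icc (a i) (b i), D ξ = 0 := fun i ξ hξ => by
    have ha := hmem i _ (left_mem_Icc.2 (hlt i).le)
    have hb := hmem i _ (right_mem_Icc.2 (hlt i).le)
    exact hprof.deriv_eq_zero ha.1 hb.1 (hlt i) (ha.2.trans hb.2.symm) hξ
  have hp0 : ∀ i, p i ≠ 0 := fun i => by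
    rw [hp i]
    exact MCH.intervalIntegral_ne_zero hmc (hlt i) fun ξ hξ =>
      hDm ξ (hmem i ξ hξ).1 (hDab i ξ hξ)
  have hx'O : ∀ i, x' i ∉ MCH.regularSet L Y := by
    intro i hi
    rw [hprof.regularSet_eq] at hi
    obtain ⟨η, hη, hηx⟩ := hi
    have ha := hmem i _ (left_mem_Icc.2 (hlt i).le)
    have := hprof.eq_of_pos (MCH.IsMonotoneProfile.regularLabels_subset hη) ha.1 hη.2
      (ha.2.trans hηx.symm)
    exact hη.2.ne' (this ▸ hDab i _ (left_mem_Icc.2 (hlt i).le))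
  set m₁ := MCH.pushDensity L Y D m₀ with hm₁
  have hm₁i : Integrable m₁ := hprof.integrable_pushDensity hmc
  have hlim : MCH.IsWeakStarLimit m T
      (volume.withDensityᵥ m₁ + ∑ i : Fin N, VectorMeasure.dirac (x' i) (p i)) := by
    intro φ
    rw [MCH.integral_withDensityᵥ_add_sum_dirac φ hm₁i, hprof.integral_mul_pushDensity]
    simp only [hp]
    rw [show _ + _ = _ from
      (hprof.integral_eq_add_sum hL hmc hx'inj hF hFhat hab hlt (map_continuous φ)).symm]
    exact hX.tendsto_integral_mul_m hL hmc hsupp hT hum.1 φ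
  refine ⟨_, hlim, fun ν hν => hν.unique hlim, hprof.isOpen_regularSet,
    ⟨m₁, hm₁i, hprof.continuousOn_pushDensity hmc, fun A hA hAO => ?_,
      fun y hy => indicator_of_notMem hy _, rfl⟩, hp0, fun y => ?_⟩
  · rw [MCH.withDensityᵥ_add_sum_dirac_apply hm₁i _ _ hA, Finset.sum_eq_zero, add_zero]
    exact fun i _ => indicator_of_notMem (fun hi => hx'O i (hAO hi)) _
  · rw [MCH.withDensityᵥ_add_sum_dirac_apply hm₁i _ _ (measurableSet_singleton y), hFhat,
      setIntegral_measure_zero _ (measure_singleton y), zero_add]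
    constructor
    · intro hne
      obtain ⟨i, -, hi⟩ := Finset.exists_ne_zero_of_sum_ne_zero hne
      exact ⟨i, mem_of_indicator_ne_zero (s := {y}) (f := fun _ => p i) hi⟩
    · rintro ⟨i, rfl⟩
      rw [Finset.sum_eq_single i, indicator_of_mem (mem_singleton _)]
      · exact hp0 i
      · exact fun j _ hj => indicator_of_notMem (s := {x' i}) (fun h => hj (hx'inj h)) (fun _ => p j)
      · exact fun h => absurd (Finset.mem_univ i) h
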